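/- Let $R$ be a commutative ring and $A$ a commutative $R$-algebra; $\otimes$ without subscript is over $R$. **Divided power chain algebras.** Let $C_*$ be a non-negatively graded commutative differential graded $R$-algebra (so $ab=(-1)^{|a||b|}ba$ and $d(ab)=d(a)b+(-1)^{|a|}a\,d(b)$). A system of divided powers on $C_*$ consists of maps $\gamma_i\colon C_n\to C_{in}$, $i\ge 0$, $n>0$, such that for all homogeneous elements $a,b$ of positive degree, $\lambda\in R$ or $\lambda\in C_0$, and $i,j\ge 0$: (a) $\gamma_0(a)=1$, $\gamma_1(a)=a$; (b) $|\gamma_i(a)|=i|a|$; (c) $\gamma_i(a)=0$ if $|a|$ is odd and $i>1$; (d) $\gamma_i(\lambda a)=\lambda^i\gamma_i(a)$; (e) $\gamma_i(a)\gamma_j(a)=\binom{i+j}{i}\gamma_{i+j}(a)$; (f) $\gamma_i(a+b)=\sum_{k+\ell=i}\gamma_k(a)\gamma_\ell(b)$ if $|a|=|b|$ is even; (g) $\gamma_i(ab)=i!\,\gamma_i(a)\gamma_i(b)=a^i\gamma_i(b)=\gamma_i(a)b^i$; (h) $\gamma_i(\gamma_j(a))=\frac{(ij)!}{i!(j!)^i}\gamma_{ij}(a)$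 if $j\ge 1$. Then $C_*$ is a divided power chain algebra if moreover $d(\gamma_i(c))=d(c)\,\gamma_{i-1}(c)$ for all $i\ge 1$ and all $c$ of positive even degree, and $\gamma_i(c)$ is a boundary for every $i\ge1$ whenever $c$ is a boundary of positive degree. A morphism of divided power chain algebras is a unital multiplicative chain map commuting with all $\gamma_i$. **Bar construction.** Let $\mathcal B_\bullet(A)$ be the simplicial commutative $R$-algebra with $\mathcal B_n(A)=A^{\otimes(n+2)}$ and componentwise multiplication, where $d_i$ ($0\le i\le n$) multiplies the adjacent factors $a_i,a_{i+1}$ of $a_0\otimes\dots\otimes a_{n+1}$ and $s_i$ inserts $1$ after $a_i$. Let $B_*(A)=N(\mathcal B_\bullet(A))$ be its normalization, $B_n(A)=\bigcap_{i=1}^n\ker(d_i)\subset\mathcal B_n(A)$ with differential $d=d_0$. Let $C_*(A)=A\otimes_{A\otimes A}B_*(A)$ be the Hochschild complex, where $A\otimes A$ acts on $A$ through multiplication and on $B_n(A)$ by $(a\otimes\tilde a)(a_0\otimes\dots\otimes a_{n+1})=aa_0\otimes\dots\otimes a_{n+1}\tilde a$. **Statement.** (1) $B_*(A)$ is a divided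 power chain algebra, with unit $1\in\mathcal B_0(A)$, with the shuffle product $$a\cdot b=\sum_{\sigma\in\mathrm{Sh}(p,q)}\varepsilon(\sigma)\,s_{\sigma(\{p,\dots,p+q-1\})}(a)\;s_{\sigma(\{0,\dots,p-1\})}(b)\qquad(a\in B_p(A),\ b\in B_q(A)),$$ and with divided powers given, for $a\in B_n(A)$ with $n>0$ even and $i\ge 0$, by $$\gamma_i(a)=\sum_{\sigma\in\mathrm{Sh}(n,\dots,n)/\Sigma_i}\varepsilon(\sigma)\prod_{j=1}^{i}s_{\sigma(\{0,\dots,in-1\}\setminus\underline{j})}(a),\qquad \underline{j}=\{(j-1)n,\dots,jn-1\}.$$ Here $\mathrm{Sh}(\dots)$ denotes the permutations that are increasing on each of the consecutive blocks of the given sizes, $\varepsilon$ is the sign, $\Sigma_i$ permutes the $i$ blocks of size $n$ and the sum runs over the representatives whose values at the first elements of the blocks increase from block to block, and $s_T=s_{t_r}\circ\dots\circ s_{t_1}$ for $T=\{t_1<\dots<t_r\}$. (2) There is exactly one divided power chain algebra structure on the complex $C_*(A)$ for which the canonical surjection $B_*(A)\to C_*(A)$, $b\mapsto 1\otimes b$,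 is a morphism of divided power chain algebras. -/

import Mathlib

open CategoryTheory Simplicial Opposite TensorProduct

universe u v w

noncomputable section

/-! ### Commutative differential graded algebras and divided power chain algebras -/

/-- A commutative differential graded `R`-algebra structure on a non-negatively graded chain
complex of `R`-modules. The product of `a` in degree `p` and `b` in degree `q` lives in
degree `n` for every `n` with `p + q = n`. -/
structure CommDGAlgebra {R : Type u} [CommRing R] (K : ChainComplex (ModuleCat.{w} R) ℕ) where
  one : K.X 0
  mul : ∀ {p q n : ℕ}, p + q = n → (K.X p →ₗ[R] K.X q →ₗ[R] K.X n)
  one_mul : ∀ {n : ℕ} (a : K.X n), mul (Nat.zero_add n) one a = a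
  mul_one : ∀ {n : ℕ} (a : K.X n), mul (Nat.add_zero n) a one = a
  mul_assoc : ∀ {p q r pq qr n : ℕ} (hpq : p + q = pq) (hn : pq + r = n)
    (hqr : q + r = qr) (hn' : p + qr = n) (a : K.X p) (b : K.X q) (c : K.X r),
    mul hn (mul hpq a b) c = mul hn' a (mul hqr b c)
  /-- graded commutativity: `a b = (-1)^{|a||b|} b a` -/
  mul_comm : ∀ {p q n : ℕ} (h : p + q = n) (h' : q + p = n) (a : K.X p) (b : K.X q),
    mul h a b = (-1 : R) ^ (p * q) • mul h' b a
  /-- Leibniz rule `d (a b) = d a b + (-1)^{|a|} a d b` when both degrees are positive -/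
  leibniz : ∀ {p q n : ℕ} (h : (p + 1) + (q + 1) = n + 1) (h₁ : p + (q + 1) = n)
    (h₂ : (p + 1) + q = n) (a : K.X (p + 1)) (b : K.X (q + 1)),
    (K.d (n + 1) n).hom (mul h a b)
      = mul h₁ ((K.d (p + 1) p).hom a) b
        + (-1 : R) ^ (p + 1) • mul h₂ a ((K.d (q + 1) q).hom b)
  /-- Leibniz rule when `|a| = 0`, where `d a = 0` -/
  leibniz_zero_left : ∀ {q : ℕ} (a : K.X 0) (b : K.X (q + 1)),
    (K.d (q + 1) q).hom (mul (Nat.zero_add (q + 1)) a b)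
      = mul (Nat.zero_add q) a ((K.d (q + 1) q).hom b)
  /-- Leibniz rule when `|b| = 0`, where `d b = 0` -/
  leibniz_zero_right : ∀ {p : ℕ} (a : K.X (p + 1)) (b : K.X 0),
    (K.d (p + 1) p).hom (mul (Nat.add_zero (p + 1)) a b)
      = mul (Nat.add_zero p) ((K.d (p + 1) p).hom a) b

/-- The `i`-th power of an element of degree `n`, an element of degree `n * i`. -/
def CommDGAlgebra.npow {R : Type u} [CommRing R] {K : ChainComplex (ModuleCat.{w} R) ℕ}
    (D : CommDGAlgebra K) {n : ℕ} (a : K.X n) (i : ℕ) : K.X (n * i) :=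
  match i with
  | 0 => D.one
  | i + 1 => D.mul rfl (CommDGAlgebra.npow D a i) a

/-- A divided power chain algebra structure on a chain complex: a commutative differential
graded algebra structure together with a system of divided powers `γ i`, defined on elements of
positive degree, which is compatible with the differential. -/
structure DividedPowerChainAlgebra {R : Type u} [CommRing R]
    (K : ChainComplex (ModuleCat.{w} R) ℕ) extends CommDGAlgebra K where
  /-- `γ i` raises the degree from `n` to `m = n * i`. -/
  γ : ∀ (i : ℕ) {n m : ℕ}, 0 < n → n * i = m → K.X n → K.X m
  γ_zero : ∀ {n : ℕ} (hn : 0 < n) (a : K.X n), γ 0 hn (Nat.mul_zero n) a = one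
  γ_one : ∀ {n : ℕ} (hn : 0 < n) (a : K.X n), γ 1 hn (Nat.mul_one n) a = a
  /-- `γ i` vanishes on elements of odd degree for `i > 1`. -/
  γ_odd : ∀ {i n m : ℕ} (hn : 0 < n) (h : n * i = m) (a : K.X n), Odd n → 1 < i →
    γ i hn h a = 0
  γ_smul : ∀ {i n m : ℕ} (hn : 0 < n) (h : n * i = m) (r : R) (a : K.X n),
    γ i hn h (r • a) = r ^ i • γ i hn h a
  /-- The same homogeneity for scalars from the degree zero part. -/
  γ_mul_degree_zero : ∀ {i n m : ℕ} (hn : 0 < n) (h : n * i = m) (h' : 0 * i + m = m)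
    (r : K.X 0) (a : K.X n),
    γ i hn h (mul (Nat.zero_add n) r a) = mul h' (toCommDGAlgebra.npow r i) (γ i hn h a)
  γ_mul_γ : ∀ {i j n m : ℕ} (hn : 0 < n) (h : n * i + n * j = m) (h' : n * (i + j) = m)
    (a : K.X n),
    mul h (γ i hn rfl a) (γ j hn rfl a) = (i + j).choose i • γ (i + j) hn h' a
  /-- `γ i (a + b) = ∑ γ k a * γ (i - k) b` for `a`, `b` of the same (even) degree. -/
  γ_add : ∀ {i n m : ℕ} (hn : 0 < n) (_ : Even n) (h : n * i = m)
    (h' : ∀ k : Fin (i + 1), n * (k : ℕ) + n * (i - (k : ℕ)) = m) (a b : K.X n),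
    γ i hn h (a + b)
      = ∑ k : Fin (i + 1), mul (h' k) (γ (k : ℕ) hn rfl a) (γ (i - (k : ℕ)) hn rfl b)
  γ_mul : ∀ {i p q n m : ℕ} (hp : 0 < p) (hq : 0 < q) (hn : 0 < n) (h : p + q = n)
    (hm : n * i = m) (hm' : p * i + q * i = m) (a : K.X p) (b : K.X q),
    γ i hn hm (mul h a b) = i.factorial • mul hm' (γ i hp rfl a) (γ i hq rfl b)
  γ_mul_left : ∀ {i p q n m : ℕ} (_ : 0 < p) (hq : 0 < q) (hn : 0 < n) (h : p + q = n)
    (hm : n * i = m) (hm' : p * i + q * i = m) (a : K.X p) (b : K.X q),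
    γ i hn hm (mul h a b) = mul hm' (toCommDGAlgebra.npow a i) (γ i hq rfl b)
  γ_mul_right : ∀ {i p q n m : ℕ} (hp : 0 < p) (_ : 0 < q) (hn : 0 < n) (h : p + q = n)
    (hm : n * i = m) (hm' : p * i + q * i = m) (a : K.X p) (b : K.X q),
    γ i hn hm (mul h a b) = mul hm' (γ i hp rfl a) (toCommDGAlgebra.npow b i)
  /-- `γ i (γ j a) = (i j)! / (i! (j!)^i) γ (i j) a` for `j ≥ 1`; the quotient of natural numbers
  is exact. -/
  γ_γ : ∀ {i j n m : ℕ} (hn : 0 < n) (hnj : 0 < n * j) (h : n * j * i = m)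
    (h' : n * (i * j) = m) (a : K.X n),
    γ i hnj h (γ j hn rfl a)
      = ((i * j).factorial / (i.factorial * j.factorial ^ i)) • γ (i * j) hn h' a
  /-- `d (γ i c) = d c * γ (i - 1) c` for `i ≥ 1` and `c` of positive (even) degree. -/
  d_γ : ∀ {i n m : ℕ} (_ : Even (n + 1)) (h : (n + 1) * (i + 1) = m + 1)
    (h' : n + (n + 1) * i = m) (c : K.X (n + 1)),
    (K.d (m + 1) m).hom (γ (i + 1) n.succ_pos h c)
      = mul h' ((K.d (n + 1) n).hom c) (γ i n.succ_pos rfl c)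
  /-- Divided powers of boundaries are boundaries. -/
  γ_boundary : ∀ {i n m : ℕ} (hn : 0 < n) (h : n * i = m) (c : K.X n), 1 ≤ i →
    (∃ b : K.X (n + 1), (K.d (n + 1) n).hom b = c) →
    ∃ b : K.X (m + 1), (K.d (m + 1) m).hom b = γ i hn h c

/-- A chain map is a morphism of divided power chain algebras if it preserves unit, products and
divided powers. -/
structure DividedPowerChainAlgebra.IsMorphism {R : Type u} [CommRing R]
    {K L : ChainComplex (ModuleCat.{w} R) ℕ} (D : DividedPowerChainAlgebra K)
    (E : DividedPowerChainAlgebra L) (f : K ⟶ L) : Prop where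
  map_one : (f.f 0).hom D.one = E.one
  map_mul : ∀ {p q n : ℕ} (h : p + q = n) (a : K.X p) (b : K.X q),
    (f.f n).hom (D.mul h a b) = E.mul h ((f.f p).hom a) ((f.f q).hom b)
  map_γ : ∀ {i n m : ℕ} (hn : 0 < n) (h : n * i = m) (a : K.X n),
    (f.f m).hom (D.γ i hn h a) = E.γ i hn h ((f.f n).hom a)

/-! ### Normalization of simplicial commutative algebras -/

section Normalization

variable {R : Type u} [CommRing R]

/-- `N_n(X) = ⋂_{i=1}^n ker (d_i : X_n → X_{n-1})`. -/
def normalizedModule (X : SimplicialObject (CommAlgCat.{w} R)) :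
    (n : ℕ) → Submodule R (X _⦋n⦌) := fun n => match n with
  | 0 => ⊤
  | n + 1 => ⨅ i : Fin (n + 1), LinearMap.ker (X.δ i.succ).hom.toLinearMap

theorem mem_normalizedModule_succ {X : SimplicialObject (CommAlgCat.{w} R)} {n : ℕ}
    {x : X _⦋n + 1⦌} :
    x ∈ normalizedModule X (n + 1) ↔ ∀ i : Fin (n + 1), (X.δ i.succ).hom x = 0 := by
  simp [normalizedModule]

theorem δ_δ_apply (X : SimplicialObject (CommAlgCat.{w} R)) {n : ℕ} {i j : Fin (n + 2)}
    (h : i ≤ j) (x : X _⦋n + 2⦌) :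
    (X.δ i).hom ((X.δ j.succ).hom x) = (X.δ j).hom ((X.δ i.castSucc).hom x) :=
  congrArg (fun f => f.hom x) (X.δ_comp_δ h)

theorem δ_zero_mem (X : SimplicialObject (CommAlgCat.{w} R)) {n : ℕ} {x : X _⦋n + 1⦌}
    (hx : x ∈ normalizedModule X (n + 1)) : (X.δ 0).hom x ∈ normalizedModule X n := by
  cases n with
  | zero => exact Submodule.mem_top
  | succ n =>
    rw [mem_normalizedModule_succ] at hx ⊢
    intro i
    have h := δ_δ_apply X (Fin.zero_le i.succ) x
    rw [hx, map_zero] at h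
    exact h.symm

/-- The differential of the normalization is the remaining face map `d_0`. -/
def normalizedD (X : SimplicialObject (CommAlgCat.{w} R)) (n : ℕ) :
    normalizedModule X (n + 1) →ₗ[R] normalizedModule X n :=
  (X.δ 0).hom.toLinearMap.restrict fun _ hx => δ_zero_mem X hx

theorem normalizedD_normalizedD (X : SimplicialObject (CommAlgCat.{w} R)) (n : ℕ)
    (x : normalizedModule X (n + 2)) : normalizedD X n (normalizedD X (n + 1) x) = 0 := by
  apply Subtype.ext
  have h := δ_δ_apply X (le_refl (0 : Fin (n + 2))) x.1
  rw [mem_normalizedModule_succ.1 x.2, map_zero] at h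
  exact h.symm

/-- The normalized chain complex of a simplicial commutative `R`-algebra. -/
def normalizedComplex (X : SimplicialObject (CommAlgCat.{w} R)) :
    ChainComplex (ModuleCat.{w} R) ℕ :=
  ChainComplex.of (fun n => ModuleCat.of R (normalizedModule X n))
    (fun n => ModuleCat.ofHom (normalizedD X n))
    (fun n => by ext x : 2; exact normalizedD_normalizedD X n x)

theorem normalizedComplex_d (X : SimplicialObject (CommAlgCat.{w} R)) (n : ℕ) :
    (normalizedComplex X).d (n + 1) n = ModuleCat.ofHom (normalizedD X n) :=
  ChainComplex.of_d (fun n => ModuleCat.of R (normalizedModule X n))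
    (fun n => ModuleCat.ofHom (normalizedD X n)) n

/-- The inclusion `N_n(X) ⊆ X_n`. -/
def normalizedIncl (X : SimplicialObject (CommAlgCat.{w} R)) (n : ℕ) :
    (normalizedComplex X).X n →ₗ[R] X _⦋n⦌ :=
  (normalizedModule X n).subtype

/-! ### Shuffles -/

/-- For `g : {0, …, n-1} → {0, …, m-1}`, the monotone map `[m] → [n]` sending `k` to the number
of `x` with `g x < k`. -/
def countBelow {n m : ℕ} (g : Fin n → Fin m) : Fin (m + 1) →o Fin (n + 1) where
  toFun k := ⟨(Finset.univ.filter fun x => (g x).castSucc < k).card,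
    Nat.lt_succ_of_le ((Finset.card_le_univ _).trans (Fintype.card_fin n).le)⟩
  monotone' k l hkl := Finset.card_le_card fun x hx => by
    simp only [Finset.mem_filter, Finset.mem_univ, true_and] at hx ⊢
    exact hx.trans_le hkl

/-- For injective `g`, with `T = {t_1 < … < t_r}` the complement of the image of `g`, this is the
iterated degeneracy `s_{t_r} ∘ … ∘ s_{t_1} : X_n → X_m`, `m = n + r`: it is induced by the
monotone surjection `[m] → [n]` that identifies `t` with `t + 1` exactly for `t ∈ T`. -/
def degeneracyOff (X : SimplicialObject (CommAlgCat.{w} R)) {n m : ℕ} (g : Fin n → Fin m) :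
    X _⦋n⦌ →ₐ[R] X _⦋m⦌ :=
  (X.map (SimplexCategory.mkHom (countBelow g)).op).hom

/-- `(p, q)`-shuffles: permutations of `{0, …, p+q-1}` that increase on the first `p` and on the
last `q` numbers. -/
def IsShuffle (p q : ℕ) (σ : Equiv.Perm (Fin (p + q))) : Prop :=
  StrictMono (fun x : Fin p => σ (Fin.castAdd q x)) ∧
    StrictMono (fun y : Fin q => σ (Fin.natAdd p y))

open Classical in
/-- The shuffle product: the shuffle map followed by the multiplication of `X`. -/
def shuffleProduct (X : SimplicialObject (CommAlgCat.{w} R)) {p q : ℕ} (a : X _⦋p⦌)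
    (b : X _⦋q⦌) : X _⦋p + q⦌ :=
  ∑ σ : Equiv.Perm (Fin (p + q)) with IsShuffle p q σ, (Equiv.Perm.sign σ : ℤ) •
    (degeneracyOff X (fun x => σ (Fin.castAdd q x)) a *
      degeneracyOff X (fun y => σ (Fin.natAdd p y)) b)

/-- The chosen representatives of `Sh(n, …, n) / Σ_i`: permutations `σ` of `{0, …, in-1}` that
increase on each of the `i` blocks `{jn, …, jn+n-1}`, and for which the values `σ(jn)` at the first
elements of the blocks increase with `j`. Here `finProdFinEquiv (j, x) = x + n * j`. -/
def IsShuffleRep (n i : ℕ) (hn : 0 < n) (σ : Equiv.Perm (Fin (i * n))) : Prop :=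
  (∀ j : Fin i, StrictMono fun x : Fin n => σ (finProdFinEquiv (j, x))) ∧
    StrictMono fun j : Fin i => σ (finProdFinEquiv (j, ⟨0, hn⟩))

open Classical in
/-- The `i`-th divided power
`∑_{σ ∈ Sh(n,…,n)/Σ_i} ε(σ) ∏_j s_{σ([in-1] ∖ j-th block)}(a)`. -/
def shuffleDividedPower (X : SimplicialObject (CommAlgCat.{w} R)) (i : ℕ) {n : ℕ} (hn : 0 < n)
    (a : X _⦋n⦌) : X _⦋i * n⦌ :=
  ∑ σ : Equiv.Perm (Fin (i * n)) with IsShuffleRep n i hn σ, (Equiv.Perm.sign σ : ℤ) •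
    ∏ j : Fin i, degeneracyOff X (fun x : Fin n => σ (finProdFinEquiv (j, x))) a

end Normalization

/-! ### The simplicial bar construction -/

section Bar

variable (R : Type u) [CommRing R] (A : Type v) [CommRing A] [Algebra R A]

/-- `a_0 ⊗ … ⊗ a_{n-1} ↦ b_0 ⊗ … ⊗ b_{m-1}`, where `b_j` is the product of the `a_k` with
`g k = j` (see `multiplyAlong_tprod`). -/
def multiplyAlong {n m : ℕ} (g : Fin n → Fin m) :
    (⨂[R] _ : Fin n, A) →ₐ[R] (⨂[R] _ : Fin m, A) :=
  PiTensorProduct.liftAlgHom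
    ((MultilinearMap.mkPiAlgebra R (Fin n) (⨂[R] _ : Fin m, A)).compLinearMap fun k =>
      (PiTensorProduct.singleAlgHom (R := R) (A := fun _ : Fin m => A) (g k)).toLinearMap)
    (by
      rw [MultilinearMap.compLinearMap_apply, MultilinearMap.mkPiAlgebra_apply]
      exact Finset.prod_eq_one fun k _ => map_one (PiTensorProduct.singleAlgHom _))
    (fun x y => by
      simp only [MultilinearMap.compLinearMap_apply, MultilinearMap.mkPiAlgebra_apply]
      rw [← Finset.prod_mul_distrib]
      exact Finset.prod_congr rfl fun k _ => map_mul (PiTensorProduct.singleAlgHom _) _ _)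

theorem multiplyAlong_tprod_eq_prod {n m : ℕ} (g : Fin n → Fin m) (a : Fin n → A) :
    multiplyAlong R A g (PiTensorProduct.tprod R a)
      = ∏ k, PiTensorProduct.tprod R (Pi.mulSingle (g k) (a k)) := by
  simp [multiplyAlong]

theorem multiplyAlong_tprod {n m : ℕ} (g : Fin n → Fin m) (a : Fin n → A) :
    multiplyAlong R A g (PiTensorProduct.tprod R a)
      = PiTensorProduct.tprod R fun j => ∏ k with g k = j, a k := by
  rw [multiplyAlong_tprod_eq_prod, ← PiTensorProduct.tprod_prod]
  congr 1
  ext j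
  simp [Finset.prod_filter, Pi.mulSingle_apply, eq_comm]

theorem multiplyAlong_single {n m : ℕ} (g : Fin n → Fin m) (k : Fin n) (a : A) :
    multiplyAlong R A g (PiTensorProduct.tprod R (Pi.mulSingle k a))
      = PiTensorProduct.tprod R (Pi.mulSingle (g k) a) := by
  rw [multiplyAlong_tprod_eq_prod]
  rw [Finset.prod_eq_single k]
  · simp
  · intro l _ hl
    rw [Pi.mulSingle_eq_of_ne hl, Pi.mulSingle_one]
    rfl
  · simp

theorem multiplyAlong_id (n : ℕ) : multiplyAlong R A (id : Fin n → Fin n) = AlgHom.id R _ := by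
  ext k a
  exact multiplyAlong_single R A id k a

theorem multiplyAlong_comp {n m l : ℕ} (g : Fin n → Fin m) (h : Fin m → Fin l) :
    (multiplyAlong R A h).comp (multiplyAlong R A g) = multiplyAlong R A (h ∘ g) := by
  ext k a
  change multiplyAlong R A h (multiplyAlong R A g (PiTensorProduct.tprod R (Pi.mulSingle k a)))
    = multiplyAlong R A (h ∘ g) (PiTensorProduct.tprod R (Pi.mulSingle k a))
  simp only [multiplyAlong_single, Function.comp]

theorem countBelow_id (n : ℕ) : (countBelow (id : Fin n → Fin n) : Fin (n + 1) → _) = id := by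
  funext k
  apply Fin.ext
  have h : (Finset.univ.filter fun x : Fin n => x.castSucc < k)
      = Finset.univ.filter fun x : Fin n => x.val < k.val := rfl
  simp only [countBelow, OrderHom.coe_mk, id, h, Fin.card_filter_val_lt]
  omega

theorem countBelow_comp {n m l : ℕ} (g : Fin n → Fin m) (h : Fin m → Fin l) (hh : Monotone h) :
    (countBelow (h ∘ g) : Fin (l + 1) → _) = countBelow g ∘ countBelow h := by
  have key : ∀ (k : Fin (l + 1)) (y : Fin m),
      (h y).castSucc < k ↔ y.castSucc < countBelow h k := by
    intro k y
    change _ ↔ y.val < (Finset.univ.filter fun x => (h x).castSucc < k).card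
    constructor
    · intro hy
      have hsub : Finset.Iic y ⊆ Finset.univ.filter fun x => (h x).castSucc < k := by
        intro z hz
        simp only [Finset.mem_filter, Finset.mem_univ, true_and]
        exact lt_of_le_of_lt (Fin.castSucc_le_castSucc_iff.2 (hh (Finset.mem_Iic.1 hz))) hy
      have := Finset.card_le_card hsub
      rw [Fin.card_Iic] at this
      omega
    · intro hy
      by_contra hk
      have hsub : (Finset.univ.filter fun x => (h x).castSucc < k) ⊆ Finset.Iio y := by
        intro z hz
        simp only [Finset.mem_filter, Finset.mem_univ, true_and] at hz
        rw [Finset.mem_Iio]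
        by_contra hzy
        exact hk (lt_of_le_of_lt (Fin.castSucc_le_castSucc_iff.2 (hh (not_lt.1 hzy))) hz)
      have := Finset.card_le_card hsub
      rw [Fin.card_Iio] at this
      omega
  funext k
  apply Fin.ext
  change (Finset.univ.filter fun x => (h (g x)).castSucc < k).card
    = (Finset.univ.filter fun x => (g x).castSucc < countBelow h k).card
  simp only [key]

/-- The bar construction: `B_n(A) = A^{⊗ (n+2)}` with componentwise multiplication. The face map
`d_i` multiplies the factors `i` and `i + 1`, and the degeneracy `s_i` inserts a unit behind the
factor `i` (see `barConstruction_δ` and `barConstruction_σ`); a general monotone map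
`f : [m] → [n]` sends the factor `j` of `A^{⊗ (n+2)}` to the factor `#{k | f k < j}` of
`A^{⊗ (m+2)}`. -/
def barConstruction : SimplicialObject (CommAlgCat.{max u v} R) where
  obj n := CommAlgCat.of R (⨂[R] _ : Fin (n.unop.len + 2), A)
  map f := CommAlgCat.ofHom (multiplyAlong R A (countBelow f.unop.toOrderHom))
  map_id n := by
    change CommAlgCat.ofHom (multiplyAlong R A (countBelow id)) = _
    rw [countBelow_id, multiplyAlong_id]
    rfl
  map_comp f g := by
    change CommAlgCat.ofHom (multiplyAlong R A
      (countBelow (f.unop.toOrderHom ∘ g.unop.toOrderHom))) = _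
    rw [countBelow_comp _ _ f.unop.toOrderHom.monotone, ← multiplyAlong_comp]
    rfl

theorem countBelow_succAbove {n : ℕ} (i : Fin (n + 1)) :
    (countBelow i.succAbove : Fin (n + 2) → Fin (n + 1)) = Fin.predAbove i := by
  funext k
  apply Fin.ext
  have hc : (Finset.univ.filter fun x : Fin n => (i.succAbove x).castSucc < k)
      = Finset.univ.filter fun x : Fin n => x.val < (i.predAbove k).val := by
    ext x
    simp only [Finset.mem_filter, Finset.mem_univ, true_and, Fin.lt_def, Fin.predAbove,
      Fin.succAbove, Fin.val_castSucc]
    split_ifs <;> simp_all <;> omega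
  change (Finset.univ.filter fun x : Fin n => (i.succAbove x).castSucc < k).card = _
  rw [hc, Fin.card_filter_val_lt]
  omega

theorem countBelow_predAbove {n : ℕ} (i : Fin n) :
    (countBelow i.predAbove : Fin (n + 1) → Fin (n + 2)) = Fin.succAbove i.castSucc.succ := by
  funext k
  apply Fin.ext
  have hc : (Finset.univ.filter fun x : Fin (n + 1) => (i.predAbove x).castSucc < k)
      = Finset.univ.filter fun x : Fin (n + 1) => x.val < (i.castSucc.succ.succAbove k).val := by
    ext x
    simp only [Finset.mem_filter, Finset.mem_univ, true_and, Fin.lt_def, Fin.predAbove,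
      Fin.succAbove, Fin.val_castSucc]
    split_ifs <;> simp_all <;> omega
  change (Finset.univ.filter fun x : Fin (n + 1) => (i.predAbove x).castSucc < k).card = _
  rw [hc, Fin.card_filter_val_lt]
  omega

theorem barConstruction_δ (n : ℕ) (i : Fin (n + 2)) :
    ((barConstruction R A).δ i).hom = multiplyAlong R A (Fin.predAbove i) :=
  congrArg (multiplyAlong R A) (countBelow_succAbove i)

theorem barConstruction_σ (n : ℕ) (i : Fin (n + 1)) :
    ((barConstruction R A).σ i).hom = multiplyAlong R A (Fin.succAbove i.castSucc.succ) :=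
  congrArg (multiplyAlong R A) (countBelow_predAbove i)

/-- `B_*(A)`, the normalized bar construction. -/
def barComplex : ChainComplex (ModuleCat.{max u v} R) ℕ :=
  normalizedComplex (barConstruction R A)

/-! ### The Hochschild complex -/

/-- `A ⊗ A → B_n(A)`, `a ⊗ a' ↦ a ⊗ 1 ⊗ … ⊗ 1 ⊗ a'`. -/
def barOuter (n : ℕ) : A ⊗[R] A →ₐ[R] (barConstruction R A) _⦋n⦌ :=
  Algebra.TensorProduct.productMap
    (PiTensorProduct.singleAlgHom (R := R) (A := fun _ : Fin (n + 2) => A) 0)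
    (PiTensorProduct.singleAlgHom (R := R) (A := fun _ : Fin (n + 2) => A) (Fin.last (n + 1)))

theorem barOuter_tmul (n : ℕ) (a b : A) :
    barOuter R A n (a ⊗ₜ b) =
      (PiTensorProduct.tprod R (Pi.mulSingle (M := fun _ : Fin (n + 2) => A) 0 a) *
        PiTensorProduct.tprod R (Pi.mulSingle (M := fun _ : Fin (n + 2) => A)
          (Fin.last (n + 1)) b) : ⨂[R] _ : Fin (n + 2), A) :=
  Algebra.TensorProduct.productMap_apply_tmul _ _ _ _

theorem δ_barOuter (n : ℕ) (i : Fin (n + 2)) (t : A ⊗[R] A) :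
    ((barConstruction R A).δ i).hom (barOuter R A (n + 1) t) = barOuter R A n t := by
  suffices h : ((barConstruction R A).δ i).hom.comp (barOuter R A (n + 1)) = barOuter R A n from
    DFunLike.congr_fun h t
  rw [barConstruction_δ]
  refine Algebra.TensorProduct.ext' fun a b => ?_
  change multiplyAlong R A (Fin.predAbove i) (barOuter R A (n + 1) (a ⊗ₜ b))
    = barOuter R A n (a ⊗ₜ b)
  rw [barOuter_tmul, barOuter_tmul]
  refine (map_mul (multiplyAlong R A (Fin.predAbove i)) _ _).trans (congrArg₂ _ ?_ ?_)
  · refine (multiplyAlong_single R A _ _ a).trans ?_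
    rw [Fin.predAbove_right_zero]
  · refine (multiplyAlong_single R A _ _ b).trans ?_
    rw [Fin.predAbove_right_last]

/-- The action `(a ⊗ a') (a_0 ⊗ … ⊗ a_{n+1}) = a a_0 ⊗ … ⊗ a_{n+1} a'` of `A ⊗ A` on the
normalized bar construction. -/
instance barModule (n : ℕ) : Module (A ⊗[R] A) (normalizedModule (barConstruction R A) n) where
  smul t x := ⟨barOuter R A n t * x.1, by
    cases n with
    | zero => exact Submodule.mem_top
    | succ n =>
      rw [mem_normalizedModule_succ]
      intro i
      rw [map_mul, mem_normalizedModule_succ.1 x.2, mul_zero]⟩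
  one_smul x := Subtype.ext (by
    change barOuter R A n 1 * x.1 = x.1
    rw [map_one, one_mul])
  mul_smul s t x := Subtype.ext (by
    change barOuter R A n (s * t) * x.1 = barOuter R A n s * (barOuter R A n t * x.1)
    rw [map_mul, mul_assoc])
  smul_zero t := Subtype.ext (mul_zero (barOuter R A n t))
  smul_add t x y := Subtype.ext (mul_add (barOuter R A n t) x.1 y.1)
  add_smul s t x := Subtype.ext (by
    change barOuter R A n (s + t) * x.1 = barOuter R A n s * x.1 + barOuter R A n t * x.1
    rw [map_add, add_mul])
  zero_smul x := Subtype.ext (by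
    change barOuter R A n 0 * x.1 = 0
    rw [map_zero, zero_mul])

theorem barModule_smul_val (n : ℕ) (t : A ⊗[R] A)
    (x : normalizedModule (barConstruction R A) n) : (t • x).1 = barOuter R A n t * x.1 := rfl

instance barModule_isScalarTower (n : ℕ) :
    IsScalarTower R (A ⊗[R] A) (normalizedModule (barConstruction R A) n) where
  smul_assoc r t x := Subtype.ext (by
    change barOuter R A n (r • t) * x.1 = r • (barOuter R A n t * x.1)
    rw [map_smul, smul_mul_assoc])

/-- `A` as an algebra over `A ⊗ A` through the multiplication `A ⊗ A → A`. -/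
instance mulAlgebra : Algebra (A ⊗[R] A) A :=
  (Algebra.TensorProduct.lmul' R (S := A)).toRingHom.toAlgebra

instance mulAlgebra_isScalarTower : IsScalarTower R (A ⊗[R] A) A :=
  IsScalarTower.of_algebraMap_eq' (Algebra.TensorProduct.lmul' R (S := A)).comp_algebraMap.symm

/-- The differential of the normalized bar construction is `A ⊗ A`-linear. -/
def barD (n : ℕ) : normalizedModule (barConstruction R A) (n + 1) →ₗ[A ⊗[R] A]
    normalizedModule (barConstruction R A) n where
  toFun := normalizedD (barConstruction R A) n
  map_add' := map_add _
  map_smul' t x := Subtype.ext (by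
    change ((barConstruction R A).δ 0).hom (barOuter R A (n + 1) t * x.1)
      = barOuter R A n t * ((barConstruction R A).δ 0).hom x.1
    rw [map_mul, δ_barOuter])

/-- `C_n(A) = A ⊗_{A ⊗ A} B_n(A)`. -/
abbrev HochschildModule (n : ℕ) : Type (max u v) :=
  A ⊗[A ⊗[R] A] (normalizedModule (barConstruction R A) n)

/-- The Hochschild complex `C_*(A) = A ⊗_{A ⊗ A} B_*(A)` with differential `id ⊗ d`. -/
def hochschildComplex : ChainComplex (ModuleCat.{max u v} R) ℕ :=
  ChainComplex.of (fun n => ModuleCat.of R (HochschildModule R A n))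
    (fun n => ModuleCat.ofHom (((barD R A n).lTensor A).restrictScalars R))
    (fun n => by
      ext x : 2
      change ((barD R A n).lTensor A) (((barD R A (n + 1)).lTensor A) x) = 0
      rw [← LinearMap.lTensor_comp_apply]
      have h : (barD R A n).comp (barD R A (n + 1)) = 0 :=
        LinearMap.ext fun x => normalizedD_normalizedD (barConstruction R A) n x
      rw [h, LinearMap.lTensor_zero, LinearMap.zero_apply])

theorem hochschildComplex_d (n : ℕ) : (hochschildComplex R A).d (n + 1) n
    = ModuleCat.ofHom (((barD R A n).lTensor A).restrictScalars R) :=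
  ChainComplex.of_d (fun n => ModuleCat.of R (HochschildModule R A n))
    (fun n => ModuleCat.ofHom (((barD R A n).lTensor A).restrictScalars R)) n

/-- The canonical chain map `B_*(A) → C_*(A)`, `b ↦ 1 ⊗ b`. -/
def barToHochschild : barComplex R A ⟶ hochschildComplex R A :=
  ChainComplex.ofHom
    (fun n => ModuleCat.ofHom
      ((TensorProduct.mk (A ⊗[R] A) A (normalizedModule (barConstruction R A) n) 1).restrictScalars R))
    (fun n => by
      ext x : 2
      change ((hochschildComplex R A).d (n + 1) n).hom
          (TensorProduct.tmul (A ⊗[R] A) (N := normalizedModule (barConstruction R A) (n + 1)) 1 x)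
        = TensorProduct.tmul (A ⊗[R] A) (N := normalizedModule (barConstruction R A) n) 1
          (((barComplex R A).d (n + 1) n).hom x)
      rw [hochschildComplex_d, show (barComplex R A).d (n + 1) n = _ from normalizedComplex_d _ n]
      rfl)

end Bar

end

/-! The proof replaces simplices by exterior forms. For a simplicial commutative algebra `X` and `a`
in `X_p`, let `hat m a` be the form of degree `p` in `m` variables over the ring `X_m` whose
coefficient at a `p`-element set `S` is the iterated degeneracy of `a` along the complement of `S`.
Shuffles with their signs are exactly what appears when exterior forms are multiplied, so the
shuffle product of `a` and `b` is the coefficient of `hat n a * hat n b` at the full set of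
variables. The whole form `hat m a * hat m b` can be recovered from that one coefficient: products
of such families are compatible with degeneracies, and a compatible homogeneous family is determined
by its top coefficient (`Coherent.eq_hat`). Hence `hat` turns the shuffle product into
multiplication of forms, and associativity, graded commutativity and so on become facts about
exterior algebras.

Divided powers are built on forms first. A form of positive even degree is a sum of monomials that
commute and square to zero, so `i!` divides its `i`-th power; in odd degree the powers with `i > 1`
vanish in characteristic zero. Over the polynomial ring on generic coefficients the quotient is
unique, and specializing it defines `dp` over every commutative ring. Identities are proved by
lifting coefficients to a polynomial ring over the integers, where they may be multiplied by
factorials, and then projecting back. Expanding a power of a form over permutations and choosing one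
representative in each orbit of block permutations gives the stated formula (`dp_apply_univ`).

Face maps also have a meaning for forms. Contraction with the smallest variable is an antiderivation
and corresponds to `d_0`, which yields the Leibniz rule and the formula for the differential of a
divided power. For a normalized simplex, the last face yields a form without the last variable, and
an inner face yields a form that depends on two neighbouring variables only through their sum. Both
properties force the top coefficient to vanish, and they survive products and divided powers well
enough to keep the results normalized. If `c = d b`, contracting the form of `b` before applying
`d_0` and then taking a divided power exhibits `γ_i c` as a boundary.

For the Hochschild complex, the map from the bar complex is surjective with kernel `I B_n`, where
`I` is the kernel of the multiplication of `A`. Surjectivity gives uniqueness. Existence requires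
that products and divided powers descend; this holds because the action of `A ⊗ A` is multiplication
by elements of degree zero, so products are bilinear over it and `γ_i` is homogeneous of degree `i`.
-/

noncomputable section

/-! ### Exterior forms with explicit coefficients -/

/-- The sign of the shuffle that sorts the elements of `S` followed by those of `T`. -/
def shuffleSign {ι : Type*} [LinearOrder ι] (S T : Finset ι) : ℤ :=
  ∏ s ∈ S, ∏ t ∈ T, if t < s then -1 else 1

section shuffleSign

variable {ι : Type*} [LinearOrder ι]

@[simp] theorem shuffleSign_empty_left (T : Finset ι) : shuffleSign ∅ T = 1 := by
  simp [shuffleSign]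

@[simp] theorem shuffleSign_empty_right (S : Finset ι) : shuffleSign S ∅ = 1 := by
  simp [shuffleSign]

theorem shuffleSign_union_left {S S' : Finset ι} (h : Disjoint S S') (T : Finset ι) :
    shuffleSign (S ∪ S') T = shuffleSign S T * shuffleSign S' T :=
  Finset.prod_union h

theorem shuffleSign_union_right (S : Finset ι) {T T' : Finset ι} (h : Disjoint T T') :
    shuffleSign S (T ∪ T') = shuffleSign S T * shuffleSign S T' := by
  simp only [shuffleSign, Finset.prod_union h, Finset.prod_mul_distrib]

/-- Each of the `|S| |T|` pairs is inverted in exactly one of the two orders. -/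
theorem shuffleSign_comm {S T : Finset ι} (h : Disjoint S T) :
    shuffleSign S T = (-1) ^ (S.card * T.card) * shuffleSign T S := by
  have key : shuffleSign S T = ∏ s ∈ S, ∏ t ∈ T, ((-1) * if s < t then (-1 : ℤ) else 1) := by
    refine Finset.prod_congr rfl fun s hs => Finset.prod_congr rfl fun t ht => ?_
    rcases lt_trichotomy s t with h' | h' | h'
    · simp [h', h'.le]
    · subst h'
      exact absurd ht (Finset.disjoint_left.1 h hs)
    · simp [h', h'.le]
  rw [key]
  simp only [Finset.prod_mul_distrib, Finset.prod_const]
  rw [shuffleSign, Finset.prod_comm, ← pow_mul, mul_comm T.card]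

theorem shuffleSign_map {κ : Type*} [LinearOrder κ] (g : κ ↪o ι) (S T : Finset κ) :
    shuffleSign (S.map g.toEmbedding) (T.map g.toEmbedding) = shuffleSign S T := by
  simp [shuffleSign, Finset.prod_map]

theorem shuffleSign_insert_left {a : ι} {S : Finset ι} (ha : a ∉ S) (T : Finset ι)
    (hT : ∀ t ∈ T, a < t) : shuffleSign (insert a S) T = shuffleSign S T := by
  rw [shuffleSign, Finset.prod_insert ha, Finset.prod_eq_one, one_mul, shuffleSign]
  exact fun t ht => by simp [(hT t ht).le]

theorem shuffleSign_insert_right {a : ι} (S : Finset ι) {T : Finset ι} (ha : a ∉ T)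
    (hS : ∀ s ∈ S, a < s) :
    shuffleSign S (insert a T) = (-1) ^ S.card * shuffleSign S T := by
  simp only [shuffleSign, Finset.prod_insert ha, Finset.prod_mul_distrib]
  congr 1
  rw [← Finset.prod_const]
  exact Finset.prod_congr rfl fun s hs => by simp [hS s hs]

theorem sum_powerset_map {α β M : Type*} [AddCommMonoid M] (g : α ↪ β) (U : Finset α)
    (f : Finset β → M) : ∑ T ∈ (U.map g).powerset, f T = ∑ S ∈ U.powerset, f (S.map g) := by
  symm
  refine Finset.sum_bij (fun S _ => S.map g) ?_ ?_ ?_ ?_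
  · intro S hS
    simpa using hS
  · intro S _ T _ h
    exact Finset.map_injective _ h
  · intro T hT
    rw [Finset.mem_powerset, Finset.subset_map_iff] at hT
    obtain ⟨S, hS, rfl⟩ := hT
    exact ⟨S, Finset.mem_powerset.2 hS, rfl⟩
  · intro S _
    rfl

end shuffleSign

/-- Exterior forms in the variables `ι` with coefficients in `P`, given by the coefficients of the
products of the variables in increasing order. -/
def Grassmann (ι : Type*) (P : Type*) := Finset ι → P

namespace Grassmann

/-! ### The exterior algebra: ring structure, functoriality, degrees -/

section Ring

variable {ι : Type*} {P Q : Type*} [CommRing P] [CommRing Q]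

instance : AddCommGroup (Grassmann ι P) := inferInstanceAs (AddCommGroup (Finset ι → P))

instance : Module P (Grassmann ι P) := inferInstanceAs (Module P (Finset ι → P))

@[ext] theorem ext {ι P : Type*} {x y : Grassmann ι P} (h : ∀ S, x S = y S) : x = y := funext h

@[simp] theorem add_apply (x y : Grassmann ι P) (S : Finset ι) : (x + y) S = x S + y S := rfl

@[simp] theorem zero_apply (S : Finset ι) : (0 : Grassmann ι P) S = 0 := rfl

@[simp] theorem smul_apply (c : P) (x : Grassmann ι P) (S : Finset ι) : (c • x) S = c * x S := rfl

@[simp] theorem nsmul_apply (c : ℕ) (x : Grassmann ι P) (S : Finset ι) : (c • x) S = c • x S := rfl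

@[simp] theorem zsmul_apply (c : ℤ) (x : Grassmann ι P) (S : Finset ι) : (c • x) S = c • x S := rfl

/-- The coefficient of a form as a linear map. -/
def coeff (S : Finset ι) : Grassmann ι P →ₗ[P] P where
  toFun x := x S
  map_add' _ _ := rfl
  map_smul' _ _ := rfl

theorem sum_apply {α : Type*} (s : Finset α) (f : α → Grassmann ι P) (S : Finset ι) :
    (∑ a ∈ s, f a) S = ∑ a ∈ s, f a S :=
  map_sum (coeff S) f s

/-- The forms of degree `n`. -/
def HasDegree (x : Grassmann ι P) (n : ℕ) : Prop := ∀ S, S.card ≠ n → x S = 0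

theorem HasDegree.add {x y : Grassmann ι P} {n : ℕ} (hx : HasDegree x n) (hy : HasDegree y n) :
    HasDegree (x + y) n := fun S hS => by rw [add_apply, hx S hS, hy S hS, add_zero]

/-- The cancellation that makes division by factorials unique; every later appeal to characteristic
zero rests on it or on its coefficientwise version. -/
theorem eq_zero_of_nsmul_eq_zero [IsDomain P] [CharZero P] {x : Grassmann ι P} {k : ℕ}
    (hk : k ≠ 0) (h : k • x = 0) : x = 0 := by
  ext S
  have := congrFun h S
  exact (smul_eq_zero.1 this).resolve_left hk

variable [LinearOrder ι]

instance : One (Grassmann ι P) := ⟨fun S => if S = ∅ then 1 else 0⟩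

instance : Mul (Grassmann ι P) :=
  ⟨fun x y U => ∑ S ∈ U.powerset, (shuffleSign S (U \ S) : P) * (x S * y (U \ S))⟩

theorem one_apply (S : Finset ι) : (1 : Grassmann ι P) S = if S = ∅ then 1 else 0 := rfl

theorem mul_apply (x y : Grassmann ι P) (U : Finset ι) : (x * y) U =
    ∑ S ∈ U.powerset, (shuffleSign S (U \ S) : P) * (x S * y (U \ S)) := rfl

protected theorem mul_assoc (x y z : Grassmann ι P) : x * y * z = x * (y * z) := by
  ext U
  simp only [mul_apply, Finset.mul_sum, Finset.sum_mul]
  rw [Finset.sum_sigma', Finset.sum_sigma']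
  -- Both sides run over ordered splittings of `U` into three pieces: `V` is the union of the first
  -- two, `S` the first.
  refine Finset.sum_bij' (fun p _ => ⟨p.2, p.1 \ p.2⟩) (fun p _ => ⟨p.1 ∪ p.2, p.1⟩) ?_ ?_ ?_ ?_ ?_
  · rintro ⟨V, S⟩ h
    simp only [Finset.mem_sigma, Finset.mem_powerset] at h ⊢
    exact ⟨h.2.trans h.1, Finset.sdiff_subset_sdiff h.1 le_rfl⟩
  · rintro ⟨S, T⟩ h
    simp only [Finset.mem_sigma, Finset.mem_powerset] at h ⊢
    exact ⟨Finset.union_subset h.1 (h.2.trans Finset.sdiff_subset), Finset.subset_union_left⟩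
  · rintro ⟨V, S⟩ h
    simp only [Finset.mem_sigma, Finset.mem_powerset] at h
    simp [Finset.union_sdiff_of_subset h.2]
  · rintro ⟨S, T⟩ h
    simp only [Finset.mem_sigma, Finset.mem_powerset] at h
    have hd : Disjoint T S := Finset.disjoint_of_subset_left h.2 Finset.sdiff_disjoint
    simp [Finset.union_sdiff_cancel_left hd.symm]
  · rintro ⟨V, S⟩ h
    simp only [Finset.mem_sigma, Finset.mem_powerset] at h
    obtain ⟨hV, hS⟩ := h
    have e : (U \ S) \ (V \ S) = U \ V := by
      ext a
      have := @hV a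
      have := @hS a
      simp only [Finset.mem_sdiff]
      tauto
    have e' : U \ S = (V \ S) ∪ (U \ V) := by
      ext a
      have := @hV a
      have := @hS a
      simp only [Finset.mem_sdiff, Finset.mem_union]
      tauto
    have hd : Disjoint (V \ S) (U \ V) :=
      Finset.disjoint_of_subset_left Finset.sdiff_subset Finset.disjoint_sdiff
    have s1 : shuffleSign V (U \ V) = shuffleSign S (U \ V) * shuffleSign (V \ S) (U \ V) := by
      rw [← shuffleSign_union_left Finset.disjoint_sdiff, Finset.union_sdiff_of_subset hS]
    have s2 : shuffleSign S (U \ S) = shuffleSign S (V \ S) * shuffleSign S (U \ V) := by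
      rw [e', shuffleSign_union_right S hd]
    simp only [e, s1, s2, Int.cast_mul]
    ring

protected theorem one_mul (x : Grassmann ι P) : 1 * x = x := by
  ext U
  rw [mul_apply, Finset.sum_eq_single ∅]
  · simp [one_apply]
  · intro S _ hS
    simp [one_apply, hS]
  · simp

protected theorem mul_one (x : Grassmann ι P) : x * 1 = x := by
  ext U
  rw [mul_apply, Finset.sum_eq_single U]
  · simp [one_apply]
  · intro S hS hne
    rw [one_apply, if_neg, mul_zero, mul_zero]
    intro h
    exact hne (le_antisymm (Finset.mem_powerset.1 hS) (Finset.sdiff_eq_empty_iff_subset.1 h))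
  · simp

instance : Ring (Grassmann ι P) :=
  { (inferInstance : AddCommGroup (Grassmann ι P)) with
    mul_assoc := Grassmann.mul_assoc
    one_mul := Grassmann.one_mul
    mul_one := Grassmann.mul_one
    left_distrib := fun x y z => by
      ext U
      simp only [mul_apply, add_apply, mul_add, Finset.sum_add_distrib]
    right_distrib := fun x y z => by
      ext U
      simp only [mul_apply, add_apply, mul_add, add_mul, Finset.sum_add_distrib]
    zero_mul := fun x => by
      ext U
      simp [mul_apply]
    mul_zero := fun x => by
      ext U
      simp [mul_apply] }

instance : Algebra P (Grassmann ι P) :=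
  Algebra.ofModule
    (fun c x y => by
      ext U
      simp only [mul_apply, smul_apply, Finset.mul_sum]
      exact Finset.sum_congr rfl fun S _ => by ring)
    (fun c x y => by
      ext U
      simp only [mul_apply, smul_apply, Finset.mul_sum]
      exact Finset.sum_congr rfl fun S _ => by ring)

/-- Change of coefficients. -/
def map (f : P →+* Q) : Grassmann ι P →+* Grassmann ι Q where
  toFun x := fun S => f (x S)
  map_one' := by
    ext S
    simp only [one_apply, apply_ite f, map_one, map_zero]
  map_zero' := by
    ext S
    exact map_zero f
  map_add' x y := by
    ext S
    exact map_add f _ _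
  map_mul' x y := by
    ext S
    refine (map_sum f _ _).trans ?_
    change _ = ∑ V ∈ S.powerset, (shuffleSign V (S \ V) : Q) * (f (x V) * f (y (S \ V)))
    exact Finset.sum_congr rfl fun V _ => by simp only [map_mul, map_intCast]

@[simp] theorem map_apply (f : P →+* Q) (x : Grassmann ι P) (S : Finset ι) :
    map f x S = f (x S) := rfl

theorem map_smul (f : P →+* Q) (c : P) (x : Grassmann ι P) :
    map f (c • x) = f c • map f x := by
  ext S
  exact map_mul f _ _

theorem map_map {T : Type*} [CommRing T] (f : P →+* Q) (g : Q →+* T) (x : Grassmann ι P) :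
    map g (map f x) = map (g.comp f) x := rfl

/-- Setting the variables outside of the image of `g` to zero. -/
def restrict {κ : Type*} [LinearOrder κ] (g : κ ↪o ι) : Grassmann ι P →+* Grassmann κ P where
  toFun x := fun S => x (S.map g.toEmbedding)
  map_one' := by
    ext S
    simp [one_apply]
  map_zero' := rfl
  map_add' x y := rfl
  map_mul' x y := by
    ext U
    rw [mul_apply]
    refine (mul_apply _ _ _).trans ((sum_powerset_map _ _ _).trans ?_)
    refine Finset.sum_congr rfl fun S _ => ?_
    rw [← Finset.map_sdiff, shuffleSign_map]

theorem restrict_apply {κ : Type*} [LinearOrder κ] (g : κ ↪o ι) (x : Grassmann ι P)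
    (S : Finset κ) : restrict g x S = x (S.map g.toEmbedding) := rfl

/-! ### Degrees -/

theorem hasDegree_one : HasDegree (1 : Grassmann ι P) 0 := fun S hS => by
  rw [one_apply, if_neg]
  rintro rfl
  exact hS rfl

theorem HasDegree.mul {x y : Grassmann ι P} {p q n : ℕ} (hx : HasDegree x p) (hy : HasDegree y q)
    (h : p + q = n) : HasDegree (x * y) n := fun U hU => by
  rw [mul_apply]
  refine Finset.sum_eq_zero fun S hS => ?_
  by_cases hp : S.card = p
  · rw [hy, mul_zero, mul_zero]
    have := Finset.card_sdiff_add_card_eq_card (Finset.mem_powerset.1 hS)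
    omega
  · rw [hx S hp, zero_mul, mul_zero]

theorem HasDegree.pow {x : Grassmann ι P} {n : ℕ} (hx : HasDegree x n) (i : ℕ) :
    HasDegree (x ^ i) (n * i) := by
  induction i with
  | zero => exact hasDegree_one
  | succ i ih => exact pow_succ x i ▸ ih.mul hx rfl

theorem HasDegree.mul_comm {x y : Grassmann ι P} {p q : ℕ} (hx : HasDegree x p)
    (hy : HasDegree y q) : x * y = (-1 : P) ^ (p * q) • (y * x) := by
  ext U
  rw [smul_apply, mul_apply, mul_apply, Finset.mul_sum]
  refine Finset.sum_nbij' (U \ ·) (U \ ·) ?_ ?_ ?_ ?_ ?_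
  · simp
  · simp
  · intro S hS
    exact Finset.sdiff_sdiff_eq_self (Finset.mem_powerset.1 hS)
  · intro S hS
    exact Finset.sdiff_sdiff_eq_self (Finset.mem_powerset.1 hS)
  · intro S hS
    rw [Finset.sdiff_sdiff_eq_self (Finset.mem_powerset.1 hS)]
    by_cases hp : S.card = p
    · by_cases hq : (U \ S).card = q
      · rw [shuffleSign_comm Finset.disjoint_sdiff, hp, hq]
        push_cast
        ring
      · rw [hy _ hq]
        simp
    · rw [hx _ hp]
      simp

/-- The exchange sign has exponent `p` times the size of the other set, which is even for every
size; so `y` need not be homogeneous. -/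
theorem HasDegree.commute {x : Grassmann ι P} {p : ℕ} (hx : HasDegree x p) (hp : Even p)
    (y : Grassmann ι P) : Commute x y := by
  ext U
  rw [mul_apply, mul_apply]
  refine Finset.sum_nbij' (U \ ·) (U \ ·) ?_ ?_ ?_ ?_ ?_
  · simp
  · simp
  · intro S hS
    exact Finset.sdiff_sdiff_eq_self (Finset.mem_powerset.1 hS)
  · intro S hS
    exact Finset.sdiff_sdiff_eq_self (Finset.mem_powerset.1 hS)
  · intro S hS
    rw [Finset.sdiff_sdiff_eq_self (Finset.mem_powerset.1 hS)]
    by_cases h : S.card = p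
    · rw [shuffleSign_comm Finset.disjoint_sdiff, h, (hp.mul_right _).neg_one_pow]
      push_cast
      ring
    · rw [hx _ h]
      simp

end Ring

end Grassmann

namespace Grassmann

/-! ### Contraction with the smallest variable -/

section Contract

variable {P : Type*} [CommRing P] {m : ℕ}

/-- The coefficient form of the smallest variable. -/
def contract : Grassmann (Fin (m + 1)) P →ₗ[P] Grassmann (Fin m) P where
  toFun x := fun S => x (insert 0 (S.map (Fin.succOrderEmb m).toEmbedding))
  map_add' _ _ := rfl
  map_smul' _ _ := rfl

theorem contract_apply (x : Grassmann (Fin (m + 1)) P) (S : Finset (Fin m)) :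
    contract x S = x (insert 0 (S.map (Fin.succOrderEmb m).toEmbedding)) := rfl

theorem zero_notMem_map_succ (S : Finset (Fin m)) :
    (0 : Fin (m + 1)) ∉ S.map (Fin.succOrderEmb m).toEmbedding := by
  simp [Fin.succ_ne_zero]

theorem HasDegree.contract {x : Grassmann (Fin (m + 1)) P} {n : ℕ} (hx : HasDegree x (n + 1)) :
    HasDegree (contract x) n := fun S hS => by
  rw [contract_apply, hx]
  rw [Finset.card_insert_of_notMem (zero_notMem_map_succ S), Finset.card_map]
  omega

theorem HasDegree.restrict {ι κ : Type*} [LinearOrder ι] [LinearOrder κ] {x : Grassmann ι P}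
    {n : ℕ} (hx : HasDegree x n) (g : κ ↪o ι) : HasDegree (restrict g x) n := fun S hS => by
  rw [restrict_apply, hx]
  rwa [Finset.card_map]

/-- The variable `0` lies in exactly one of the two factors. In the second factor it has to be moved
past the `p` variables of the first, which costs `(-1)^p`. This is the source of the Leibniz rule.
-/
theorem contract_mul {x : Grassmann (Fin (m + 1)) P} {p : ℕ} (hx : HasDegree x p)
    (y : Grassmann (Fin (m + 1)) P) :
    contract (x * y) = contract x * restrict (Fin.succOrderEmb m) y
      + (-1 : P) ^ p • (restrict (Fin.succOrderEmb m) x * contract y) := by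
  ext U
  have h0 := zero_notMem_map_succ (m := m)
  have hpos : ∀ (S : Finset (Fin m)), ∀ t ∈ S.map (Fin.succOrderEmb m).toEmbedding,
      (0 : Fin (m + 1)) < t := fun S t ht =>
    Fin.pos_of_ne_zero fun h => h0 S (h ▸ ht)
  rw [contract_apply, mul_apply, Finset.sum_powerset_insert (h0 U), sum_powerset_map,
    sum_powerset_map, add_apply, smul_apply, mul_apply, mul_apply, add_comm, Finset.mul_sum]
  congr 1
  · refine Finset.sum_congr rfl fun V hV => ?_
    have e : insert 0 (U.map (Fin.succOrderEmb m).toEmbedding) \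
        insert 0 (V.map (Fin.succOrderEmb m).toEmbedding)
        = (U \ V).map (Fin.succOrderEmb m).toEmbedding := by
      rw [Finset.insert_sdiff_insert, Finset.sdiff_insert_of_notMem (h0 U), Finset.map_sdiff]
    rw [e, shuffleSign_insert_left (h0 V) _ (hpos _), shuffleSign_map, contract_apply,
      restrict_apply]
  · refine Finset.sum_congr rfl fun V hV => ?_
    have e : insert 0 (U.map (Fin.succOrderEmb m).toEmbedding) \
        V.map (Fin.succOrderEmb m).toEmbedding
        = insert 0 ((U \ V).map (Fin.succOrderEmb m).toEmbedding) := by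
      rw [Finset.insert_sdiff_of_notMem _ (h0 V), Finset.map_sdiff]
    rw [e, shuffleSign_insert_right _ (h0 _) (hpos _), shuffleSign_map, contract_apply,
      restrict_apply, Finset.card_map]
    by_cases hp : V.card = p
    · rw [hp]
      push_cast
      ring
    · rw [hx _ (by rwa [Finset.card_map])]
      simp

theorem contract_pow {x : Grassmann (Fin (m + 1)) P} {n : ℕ} (hx : HasDegree x n) (hn : Even n)
    (i : ℕ) : contract (x ^ (i + 1))
      = (i + 1) • (contract x * restrict (Fin.succOrderEmb m) x ^ i) := by
  induction i with
  | zero => simp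
  | succ i ih =>
    rw [pow_succ x (i + 1), contract_mul (hx.pow (i + 1)), ih, (hn.mul_right _).neg_one_pow,
      one_smul, map_pow, (((hx.restrict _).commute hn _).pow_left _).eq, smul_mul_assoc,
      mul_assoc, ← pow_succ, succ_nsmul _ (i + 1), succ_nsmul]

end Contract

/-! ### Exchanging two neighbouring variables -/

section Swap

variable {ι : Type*} [LinearOrder ι] {P : Type*} [CommRing P]

/-- The sign by which the exchange of `a` and `b` acts on the product of the variables in `S`. -/
def swapSign (a b : ι) (S : Finset ι) : ℤ := if a ∈ S ∧ b ∈ S then -1 else 1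

/-- No element lies between `a` and `b`, so exchanging them changes the relative order of no pair
except `a`, `b` itself. This gives a sign exactly when `S` contains one of them and `T` the other,
and the `swapSign` factors account for it. -/
theorem shuffleSign_map_swap {a b : ι} (hab : a ⋖ b) {S T : Finset ι} (h : Disjoint S T) :
    swapSign a b (S ∪ T) * shuffleSign (S.map (Equiv.swap a b).toEmbedding)
        (T.map (Equiv.swap a b).toEmbedding)
      = shuffleSign S T * (swapSign a b S * swapSign a b T) := by
  have hne : a ≠ b := hab.1.ne
  have hlt : ∀ c, c ≠ a → c ≠ b → (c < a ↔ c < b) := fun c ha hb =>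
    ⟨fun h => h.trans hab.1, fun h => (le_of_not_gt fun h' => hab.2 h' h).lt_of_ne ha⟩
  have hlt' : ∀ c, c ≠ a → c ≠ b → (a < c ↔ b < c) := fun c ha hb =>
    ⟨fun h => (le_of_not_gt fun h' => hab.2 h h').lt_of_ne hb.symm, fun h => hab.1.trans h⟩
  have key : ∀ s ∈ S, ∀ t ∈ T, (if Equiv.swap a b t < Equiv.swap a b s then (-1 : ℤ) else 1)
      = (if t < s then -1 else 1) * ((if s = a then if t = b then -1 else 1 else 1) *
        (if s = b then if t = a then -1 else 1 else 1)) := by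
    intro s hs t ht
    have hst : s ≠ t := fun h' => Finset.disjoint_left.1 h hs (h' ▸ ht)
    by_cases hsa : s = a
    · subst hsa
      by_cases htb : t = b
      · subst htb
        simp [hne.symm, hab.1, hab.1.le]
      · rw [Equiv.swap_apply_left, Equiv.swap_apply_of_ne_of_ne hst.symm htb]
        simp [htb, hne, hlt t hst.symm htb]
    · by_cases hsb : s = b
      · subst hsb
        by_cases hta : t = a
        · subst hta
          simp [hne.symm, hab.1, hab.1.le]
        · rw [Equiv.swap_apply_right, Equiv.swap_apply_of_ne_of_ne hta hst.symm]
          simp [hta, hne.symm, hlt t hta hst.symm]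
      · rw [Equiv.swap_apply_of_ne_of_ne hsa hsb]
        by_cases hta : t = a
        · subst hta
          simp [hsa, hsb, hlt' s hsa hsb]
        · by_cases htb : t = b
          · subst htb
            simp [hsa, hsb, hlt' s hsa hsb]
          · rw [Equiv.swap_apply_of_ne_of_ne hta htb]
            simp [hsa, hsb]
  have e : shuffleSign (S.map (Equiv.swap a b).toEmbedding) (T.map (Equiv.swap a b).toEmbedding)
      = shuffleSign S T * ((if a ∈ S then if b ∈ T then -1 else 1 else 1) *
        (if b ∈ S then if a ∈ T then -1 else 1 else 1)) := by
    simp only [shuffleSign, Finset.prod_map, Equiv.coe_toEmbedding]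
    rw [Finset.prod_congr rfl fun s hs => Finset.prod_congr rfl (key s hs)]
    simp only [Finset.prod_mul_distrib]
    congr 2
    · have : ∀ s, (∏ t ∈ T, if s = a then if t = b then (-1 : ℤ) else 1 else 1)
          = if s = a then if b ∈ T then -1 else 1 else 1 := fun s => by
        split_ifs <;> simp_all
      simp only [this, Finset.prod_ite_eq']
    · have : ∀ s, (∏ t ∈ T, if s = b then if t = a then (-1 : ℤ) else 1 else 1)
          = if s = b then if a ∈ T then -1 else 1 else 1 := fun s => by
        split_ifs <;> simp_all
      simp only [this, Finset.prod_ite_eq']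
  rw [e]
  clear key e
  have h1 : a ∈ S → a ∉ T := fun h' => Finset.disjoint_left.1 h h'
  have h2 : b ∈ S → b ∉ T := fun h' => Finset.disjoint_left.1 h h'
  simp only [swapSign, Finset.mem_union]
  by_cases ha : a ∈ S
  · have ha' := h1 ha
    by_cases hb : b ∈ S
    · simp [ha, ha', hb, h2 hb]
    · by_cases hb' : b ∈ T <;> simp [ha, ha', hb, hb']
  · by_cases hb : b ∈ S
    · by_cases ha' : a ∈ T <;> simp [ha, ha', hb, h2 hb]
    · by_cases ha' : a ∈ T <;> by_cases hb' : b ∈ T <;> simp [ha, ha', hb, hb']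

/-- The automorphism that exchanges two neighbouring variables. -/
def swapHom {a b : ι} (hab : a ⋖ b) : Grassmann ι P →+* Grassmann ι P where
  toFun x := fun S => (swapSign a b S : P) * x (S.map (Equiv.swap a b).toEmbedding)
  map_one' := by
    ext S
    by_cases hS : S = ∅ <;> simp [one_apply, hS, swapSign]
  map_zero' := by
    ext S
    exact mul_zero _
  map_add' x y := by
    ext S
    exact mul_add _ _ _
  map_mul' x y := by
    ext U
    rw [mul_apply]
    refine (congrArg _ ((mul_apply _ _ _).trans (sum_powerset_map _ _ _))).trans ?_
    rw [Finset.mul_sum]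
    refine Finset.sum_congr rfl fun S hS => ?_
    have h := shuffleSign_map_swap hab (Finset.disjoint_sdiff (s := S) (t := U))
    rw [Finset.union_sdiff_of_subset (Finset.mem_powerset.1 hS)] at h
    have h' := congrArg (Int.cast : ℤ → P) h
    push_cast at h'
    rw [← Finset.map_sdiff, ← mul_assoc, h']
    ring

theorem swapHom_apply {a b : ι} (hab : a ⋖ b) (x : Grassmann ι P) (S : Finset ι) :
    swapHom hab x S = (swapSign a b S : P) * x (S.map (Equiv.swap a b).toEmbedding) := rfl

theorem map_swap_eq_self {a b : ι} {U : Finset ι} (ha : a ∈ U) (hb : b ∈ U) :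
    U.map (Equiv.swap a b).toEmbedding = U := by
  refine Finset.eq_of_subset_of_card_le (fun c hc => ?_) (by rw [Finset.card_map])
  simp only [Finset.mem_map, Equiv.coe_toEmbedding] at hc
  obtain ⟨d, hd, rfl⟩ := hc
  rw [Equiv.swap_apply_def]
  split_ifs <;> assumption

/-- Such a coefficient equals its own negative; characteristic zero excludes `2`-torsion. -/
theorem apply_eq_zero_of_swapHom_eq [IsDomain P] [CharZero P] {a b : ι} (hab : a ⋖ b)
    {x : Grassmann ι P} (hx : swapHom hab x = x) {U : Finset ι} (ha : a ∈ U) (hb : b ∈ U) :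
    x U = 0 := by
  have h := congrFun hx U
  rw [swapHom_apply, map_swap_eq_self ha hb, swapSign, if_pos ⟨ha, hb⟩] at h
  push_cast at h
  rw [neg_one_mul] at h
  exact self_eq_neg.1 h.symm

end Swap
end Grassmann

/-! ### Divided powers of even forms -/

theorem add_pow_succ_of_mul_self_eq_zero {B : Type*} [Ring B] {a : B} (ha : a * a = 0)
    (hc : ∀ b, Commute a b) (b : B) (i : ℕ) :
    (a + b) ^ (i + 1) = b ^ (i + 1) + (i + 1) • (a * b ^ i) := by
  induction i with
  | zero => simp [add_comm]
  | succ i ih =>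
    have h1 : b ^ (i + 1) * a = a * b ^ (i + 1) := (hc _).eq.symm
    have h2 : a * b ^ i * a = 0 := by rw [(hc (a * b ^ i)).eq.symm, ← mul_assoc, ha, zero_mul]
    rw [pow_succ, ih, mul_add, add_mul, add_mul, h1, smul_mul_assoc, h2, smul_zero, add_zero,
      smul_mul_assoc, mul_assoc, ← pow_succ, ← pow_succ, succ_nsmul _ (i + 1)]
    abel

/-- The witness is the `i`-th elementary symmetric polynomial in the `z a`, since only the
square-free terms of the power survive. -/
theorem exists_factorial_nsmul_eq_sum_pow {B α : Type*} [Ring B] (s : Finset α) (z : α → B)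
    (hz : ∀ a, z a * z a = 0) (hc : ∀ a b, Commute (z a) b) (i : ℕ) :
    ∃ w, i.factorial • w = (∑ a ∈ s, z a) ^ i := by
  classical
  induction s using Finset.induction_on generalizing i with
  | empty =>
    cases i with
    | zero => exact ⟨1, by simp⟩
    | succ i => exact ⟨0, by simp⟩
  | insert a s ha ih =>
    rw [Finset.sum_insert ha]
    cases i with
    | zero => exact ⟨1, by simp⟩
    | succ i =>
      obtain ⟨v, hv⟩ := ih (i + 1)
      obtain ⟨v', hv'⟩ := ih i
      -- The recursion of elementary symmetric polynomials when one variable `z a` is added.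
      refine ⟨v + z a * v', ?_⟩
      rw [add_pow_succ_of_mul_self_eq_zero (hz a) (hc a), ← hv, ← hv', smul_add, mul_smul_comm,
        ← mul_smul, Nat.factorial_succ]

namespace Grassmann

variable {ι : Type*} [LinearOrder ι] {P Q : Type*} [CommRing P] [CommRing Q]

theorem HasDegree.map {ι : Type*} {P Q : Type*} [CommRing P] [CommRing Q] [LinearOrder ι]
    {x : Grassmann ι P} {n : ℕ} (hx : HasDegree x n) (f : P →+* Q) :
    HasDegree (map f x) n := fun S hS => by
  rw [map_apply, hx S hS, map_zero]

/-- The multiple of a single monomial. -/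
def single (S : Finset ι) (c : P) : Grassmann ι P := fun T => if T = S then c else 0

theorem hasDegree_single (S : Finset ι) (c : P) : HasDegree (single S c) S.card := fun T hT => by
  rw [single, if_neg]
  rintro rfl
  exact hT rfl

theorem single_mul_single_self {S : Finset ι} (hS : S.Nonempty) (c : P) :
    single S c * single S c = 0 := by
  ext U
  rw [mul_apply, zero_apply]
  refine Finset.sum_eq_zero fun V hV => ?_
  by_cases h : V = S
  · subst h
    rw [single, single, if_neg (c := U \ V = V), mul_zero, mul_zero]
    intro h
    obtain ⟨a, ha⟩ := hS
    exact (Finset.mem_sdiff.1 (h.symm ▸ ha)).2 ha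
  · rw [single, if_neg h, zero_mul, mul_zero]

theorem eq_sum_single [Fintype ι] (x : Grassmann ι P) : x = ∑ S, single S (x S) := by
  ext T
  rw [sum_apply, Finset.sum_eq_single T]
  · simp [single]
  · intro S _ hS
    simp [single, hS.symm]
  · simp

theorem HasDegree.mul_self_of_domain [IsDomain P] [CharZero P] {x : Grassmann ι P} {n : ℕ}
    (hx : HasDegree x n) (hn : Odd n) : x * x = 0 := by
  have h := hx.mul_comm hx
  rw [(hn.mul hn).neg_one_pow, neg_smul, one_smul, eq_neg_iff_add_eq_zero, ← two_nsmul] at h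
  exact eq_zero_of_nsmul_eq_zero two_ne_zero h

theorem pow_eq_zero_of_mul_self {B : Type*} [Ring B] {x : B} (hx : x * x = 0) {i : ℕ}
    (hi : 1 < i) : x ^ i = 0 := by
  rw [← Nat.sub_add_cancel (Nat.succ_le_of_lt hi), pow_add, pow_two, hx, mul_zero]

theorem exists_factorial_nsmul_eq_pow [Fintype ι] [IsDomain P] [CharZero P] {x : Grassmann ι P}
    {n : ℕ} (hx : HasDegree x n) (h0 : 0 < n) (i : ℕ) : ∃ w, i.factorial • w = x ^ i := by
  rcases n.even_or_odd with hn | hn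
  · have h : ∃ w, i.factorial • w = (∑ S, single S (x S)) ^ i := by
      refine exists_factorial_nsmul_eq_sum_pow Finset.univ _ (fun S => ?_) (fun S y => ?_) i
      · by_cases hS : S.card = n
        · exact single_mul_single_self (Finset.card_pos.1 (hS ▸ h0)) _
        · rw [hx S hS, show single S (0 : P) = 0 from by ext T; simp [single], zero_mul]
      · by_cases hS : S.card = n
        · exact (hasDegree_single S _).commute (hS ▸ hn) y
        · rw [hx S hS, show single S (0 : P) = 0 from by ext T; simp [single]]
          exact Commute.zero_left y
    rwa [← eq_sum_single] at h
  · rcases Nat.lt_or_ge 1 i with hi | hi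
    · exact ⟨0, by rw [smul_zero, pow_eq_zero_of_mul_self (hx.mul_self_of_domain hn) hi]⟩
    · exact ⟨x ^ i, by rw [Nat.factorial_eq_one.2 hi, one_smul]⟩

/-- The generic form of degree `n`. -/
def generic (ι : Type*) (n : ℕ) : Grassmann ι (MvPolynomial (Finset ι) ℤ) :=
  fun S => if S.card = n then MvPolynomial.X S else 0

theorem hasDegree_generic (ι : Type*) (n : ℕ) : HasDegree (generic ι n) n := fun _ hS => if_neg hS

open Classical in
/-- The `i`-th divided power of the generic form of degree `n`. -/
def genericDP (ι : Type*) [LinearOrder ι] (n i : ℕ) :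
    Grassmann ι (MvPolynomial (Finset ι) ℤ) :=
  -- For finite `ι` and `n > 0` a witness exists, and it is unique because the coefficients are
  -- torsion-free.
  if h : ∃ w, i.factorial • w = generic ι n ^ i then h.choose else 0

/-- The ring homomorphism that evaluates the generic coefficients. -/
def evalCoeff {ι : Type*} {P : Type*} [CommRing P] (x : Grassmann ι P) :
    MvPolynomial (Finset ι) ℤ →+* P :=
  MvPolynomial.eval₂Hom (Int.castRingHom P) x

theorem evalCoeff_X {ι : Type*} {P : Type*} [CommRing P] (x : Grassmann ι P) (S : Finset ι) :
    evalCoeff x (MvPolynomial.X S) = x S :=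
  MvPolynomial.eval₂_X _ _ _

theorem map_evalCoeff_generic {x : Grassmann ι P} {n : ℕ} (hx : HasDegree x n) :
    map (evalCoeff x) (generic ι n) = x := by
  ext S
  rw [map_apply, generic]
  split_ifs with h
  · exact evalCoeff_X x S
  · rw [map_zero, hx S h]

/-- The `i`-th divided power of a form of positive even degree `n`. -/
def dp (n i : ℕ) (x : Grassmann ι P) : Grassmann ι P :=
  map (evalCoeff x) (genericDP ι n i)

/-- Both sides specialize the same universal form, and the two specializations agree on the generic
coefficients. -/
theorem map_dp (f : P →+* Q) (n i : ℕ) (x : Grassmann ι P) :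
    map f (dp n i x) = dp n i (map f x) := by
  rw [dp, dp, map_map]
  congr 1
  congr 1
  refine MvPolynomial.ringHom_ext (fun r => ?_) fun S => ?_
  · simp [evalCoeff]
  · rw [RingHom.comp_apply, evalCoeff_X, evalCoeff_X, map_apply]

/-- The divisibility is established once, over the characteristic zero domain of generic
coefficients, and specialized to an arbitrary ring. -/
theorem factorial_nsmul_dp [Fintype ι] {x : Grassmann ι P} {n : ℕ} (hx : HasDegree x n)
    (h0 : 0 < n) (i : ℕ) : i.factorial • dp n i x = x ^ i := by
  have h : i.factorial • genericDP ι n i = generic ι n ^ i := by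
    have h' := exists_factorial_nsmul_eq_pow (hasDegree_generic ι n) h0 i
    rw [genericDP, dif_pos h']
    exact h'.choose_spec
  rw [dp, ← map_nsmul, h, map_pow, map_evalCoeff_generic hx]

theorem eq_of_nsmul_eq [IsDomain P] [CharZero P] {x y : Grassmann ι P} {k : ℕ}
    (hk : k ≠ 0) (h : k • x = k • y) : x = y :=
  sub_eq_zero.1 (eq_zero_of_nsmul_eq_zero hk (by rw [smul_sub, h, sub_self]))

theorem dp_eq_of_factorial_nsmul [Fintype ι] [IsDomain P] [CharZero P] {x w : Grassmann ι P}
    {n : ℕ} (hx : HasDegree x n) (h0 : 0 < n) {i : ℕ}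
    (hw : i.factorial • w = x ^ i) : dp n i x = w :=
  eq_of_nsmul_eq i.factorial_ne_zero ((factorial_nsmul_dp hx h0 i).trans hw.symm)

/-! ### Lifting forms to a torsion-free coefficient ring -/

/-- The set-theoretic section, preserving zero, of `MvPolynomial P ℤ → P`. -/
def liftScalar {P : Type*} [CommRing P] (c : P) : MvPolynomial P ℤ :=
  open Classical in if c = 0 then 0 else MvPolynomial.X c

/-- The projection `MvPolynomial P ℤ → P`. -/
def evalScalar (P : Type*) [CommRing P] : MvPolynomial P ℤ →+* P :=
  MvPolynomial.eval₂Hom (Int.castRingHom P) id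

theorem evalScalar_liftScalar (c : P) : evalScalar P (liftScalar c) = c := by
  rw [liftScalar]
  split_ifs with h
  · rw [map_zero, h]
  · simp [evalScalar]

/-- The coefficientwise lift of a form to a torsion-free coefficient ring. -/
def lift {ι : Type*} {P : Type*} [CommRing P] (x : Grassmann ι P) :
    Grassmann ι (MvPolynomial P ℤ) := fun S => liftScalar (x S)

theorem map_lift (x : Grassmann ι P) : map (evalScalar P) (lift x) = x := by
  ext S
  exact evalScalar_liftScalar _

/-- The lift is not additive; that it preserves zeros is what carries degree and vanishing
conditions on single coefficients over to it. -/
theorem lift_eq_zero {ι : Type*} {x : Grassmann ι P} {S : Finset ι} (h : x S = 0) : lift x S = 0 :=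
  if_pos h

theorem HasDegree.lift {ι : Type*} {x : Grassmann ι P} {n : ℕ} (hx : HasDegree x n) :
    HasDegree (lift x) n := fun S hS => lift_eq_zero (hx S hS)

/-- Graded commutativity alone only gives `2 x² = 0`; the lift removes the factor `2`. -/
theorem HasDegree.mul_self {x : Grassmann ι P} {n : ℕ} (hx : HasDegree x n) (hn : Odd n) :
    x * x = 0 := by
  rw [← map_lift x, ← map_mul, hx.lift.mul_self_of_domain hn, map_zero]

/-- If one degree is even, that factor is central. If both are odd, reordering would produce signs,
but both sides vanish for `i > 1`. -/
theorem HasDegree.mul_pow {x y : Grassmann ι P} {p q : ℕ} (hx : HasDegree x p)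
    (hy : HasDegree y q) (i : ℕ) : (x * y) ^ i = x ^ i * y ^ i := by
  rcases p.even_or_odd with hp | hp
  · exact (hx.commute hp y).mul_pow i
  · rcases q.even_or_odd with hq | hq
    · exact (hy.commute hq x).symm.mul_pow i
    · rcases Nat.lt_or_ge 1 i with hi | hi
      · have h : x * y * (x * y) = 0 := by
          rw [mul_assoc, hy.mul_comm (hx.mul hy rfl), mul_assoc, hy.mul_self hq, mul_zero,
            smul_zero, mul_zero]
        rw [pow_eq_zero_of_mul_self h hi, pow_eq_zero_of_mul_self (hx.mul_self hp) hi, zero_mul]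
      · interval_cases i <;> simp

theorem HasDegree.smul {ι : Type*} {x : Grassmann ι P} {n : ℕ} (hx : HasDegree x n) (c : P) :
    HasDegree (c • x) n := fun S hS => by
  rw [smul_apply, hx S hS, mul_zero]

/-! ### Identities for divided powers of forms -/

section

variable [Fintype ι] {x y : Grassmann ι P} {n : ℕ}

/-- The pattern for most results of this section: replace `x` by its lift, use `i! • dp n i x = x ^
i` there and cancel the factorial, then project back by `map_dp`. -/
theorem HasDegree.dp (hx : HasDegree x n) (h0 : 0 < n) (i : ℕ) :
    HasDegree (dp n i x) (n * i) := by
  rw [← map_lift x, ← map_dp]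
  refine HasDegree.map (fun S hS => ?_) _
  have h := congrFun (factorial_nsmul_dp hx.lift h0 i) S
  rw [hx.lift.pow i S hS, nsmul_apply] at h
  exact (smul_eq_zero.1 h).resolve_left i.factorial_ne_zero

theorem dp_zero (hx : HasDegree x n) (h0 : 0 < n) : dp n 0 x = 1 := by
  have := factorial_nsmul_dp hx h0 0
  rwa [Nat.factorial_zero, one_smul, pow_zero] at this

theorem dp_one (hx : HasDegree x n) (h0 : 0 < n) : dp n 1 x = x := by
  have := factorial_nsmul_dp hx h0 1
  rwa [Nat.factorial_one, one_smul, pow_one] at this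

theorem dp_smul (hx : HasDegree x n) (h0 : 0 < n) (i : ℕ) (c : P) :
    dp n i (c • x) = c ^ i • dp n i x := by
  rw [← map_lift x, ← evalScalar_liftScalar c, ← map_smul, ← map_dp, ← map_dp, ← map_pow,
    ← map_smul]
  congr 1
  refine dp_eq_of_factorial_nsmul (hx.lift.smul _) h0 ?_
  rw [smul_comm, factorial_nsmul_dp hx.lift h0, smul_pow]

theorem dp_mul_dp (hx : HasDegree x n) (h0 : 0 < n) (i j : ℕ) :
    dp n i x * dp n j x = (i + j).choose i • dp n (i + j) x := by
  rw [← map_lift x, ← map_dp, ← map_dp, ← map_dp, ← map_mul, ← map_nsmul]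
  congr 1
  refine eq_of_nsmul_eq (mul_ne_zero i.factorial_ne_zero j.factorial_ne_zero) ?_
  rw [← mul_smul, mul_comm _ (Nat.choose _ _), ← mul_assoc, Nat.choose_symm_add,
    Nat.add_choose_mul_factorial_mul_factorial,
    factorial_nsmul_dp hx.lift h0, pow_add, ← factorial_nsmul_dp hx.lift h0,
    ← factorial_nsmul_dp hx.lift h0, smul_mul_smul_comm]

theorem dp_add (hx : HasDegree x n) (hy : HasDegree y n) (hn : Even n) (h0 : 0 < n) (i : ℕ) :
    dp n i (x + y) = ∑ k ∈ Finset.range (i + 1), dp n k x * dp n (i - k) y := by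
  rw [← map_lift x, ← map_lift y, ← map_add, ← map_dp]
  simp only [← map_dp, ← map_mul, ← map_sum]
  congr 1
  refine dp_eq_of_factorial_nsmul (hx.lift.add hy.lift) h0 ?_
  rw [(hx.lift.commute hn _).add_pow, Finset.smul_sum]
  refine Finset.sum_congr rfl fun k hk => ?_
  have hk' : k ≤ i := Nat.lt_succ_iff.1 (Finset.mem_range.1 hk)
  rw [← factorial_nsmul_dp hx.lift h0, ← factorial_nsmul_dp hy.lift h0, smul_mul_smul_comm,
    ← Nat.choose_mul_factorial_mul_factorial hk', ← nsmul_eq_mul', ← mul_smul, mul_assoc]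

theorem dp_comp (hx : HasDegree x n) (h0 : 0 < n) (i : ℕ) {j : ℕ} (hj : 0 < j) :
    dp (n * j) i (dp n j x)
      = ((i * j).factorial / (i.factorial * j.factorial ^ i)) • dp n (i * j) x := by
  rw [← map_lift x, ← map_dp, ← map_dp, ← map_dp, ← map_nsmul]
  congr 1
  -- The quotient of factorials counts the partitions of `i * j` points into `i` blocks of size `j`,
  -- so the division is exact.
  have hb := Nat.uniformBell_mul_eq i hj.ne'
  have hk : i.factorial * j.factorial ^ i ≠ 0 :=
    mul_ne_zero i.factorial_ne_zero (pow_ne_zero _ j.factorial_ne_zero)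
  refine eq_of_nsmul_eq hk ?_
  rw [← mul_smul, Nat.mul_div_cancel' ⟨i.uniformBell j, by rw [← hb]; ring⟩,
    factorial_nsmul_dp hx.lift h0, mul_comm i j, pow_mul, ← factorial_nsmul_dp hx.lift h0,
    smul_pow, mul_comm, mul_smul, factorial_nsmul_dp (hx.lift.dp h0 j) (Nat.mul_pos h0 hj)]

theorem dp_mul_left {p q : ℕ} (hx : HasDegree x p) (hy : HasDegree y q) (hq : 0 < q) (i : ℕ) :
    dp (p + q) i (x * y) = x ^ i * dp q i y := by
  rw [← map_lift x, ← map_lift y, ← map_mul, ← map_dp, ← map_dp, ← map_pow, ← map_mul]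
  congr 1
  refine dp_eq_of_factorial_nsmul (hx.lift.mul hy.lift rfl) (by omega) ?_
  rw [← mul_smul_comm, factorial_nsmul_dp hy.lift hq, hx.lift.mul_pow hy.lift]

theorem dp_mul_right {p q : ℕ} (hx : HasDegree x p) (hy : HasDegree y q) (hp : 0 < p) (i : ℕ) :
    dp (p + q) i (x * y) = dp p i x * y ^ i := by
  rw [← map_lift x, ← map_lift y, ← map_mul, ← map_dp, ← map_dp, ← map_pow, ← map_mul]
  congr 1
  refine dp_eq_of_factorial_nsmul (hx.lift.mul hy.lift rfl) (by omega) ?_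
  rw [← smul_mul_assoc, factorial_nsmul_dp hx.lift hp, hx.lift.mul_pow hy.lift]

theorem dp_odd (hx : HasDegree x n) (hn : Odd n) {i : ℕ} (hi : 1 < i) : dp n i x = 0 := by
  rw [← map_lift x, ← map_dp]
  suffices h : dp n i (lift x) = 0 by rw [h, map_zero]
  refine dp_eq_of_factorial_nsmul hx.lift hn.pos ?_
  rw [smul_zero, pow_eq_zero_of_mul_self (hx.lift.mul_self hn) hi]

theorem restrict_dp {κ : Type*} [LinearOrder κ] [Fintype κ] (hx : HasDegree x n) (h0 : 0 < n)
    (i : ℕ) (g : κ ↪o ι) : restrict g (dp n i x) = dp n i (restrict g x) := by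
  have h : ∀ z : Grassmann ι (MvPolynomial P ℤ),
      restrict g (map (evalScalar P) z) = map (evalScalar P) (restrict g z) := fun z => rfl
  rw [← map_lift x, ← map_dp, h, h, ← map_dp]
  congr 1
  refine (dp_eq_of_factorial_nsmul (hx.lift.restrict g) h0 ?_).symm
  rw [← map_nsmul, factorial_nsmul_dp hx.lift h0, map_pow]

end

/-- The power rule for an antiderivation on even forms (`contract_pow`), divided by `(i + 1)!`. It
becomes the formula for `d (γ_i c)`. -/
theorem contract_dp {m : ℕ} {x : Grassmann (Fin (m + 1)) P} {n : ℕ} (hx : HasDegree x n)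
    (hn : Even n) (h0 : 0 < n) (i : ℕ) : contract (dp n (i + 1) x)
      = contract x * dp n i (restrict (Fin.succOrderEmb m) x) := by
  have h : ∀ z : Grassmann (Fin (m + 1)) (MvPolynomial P ℤ),
      contract (map (evalScalar P) z) = map (evalScalar P) (contract z) := fun z => rfl
  have h' : ∀ z : Grassmann (Fin (m + 1)) (MvPolynomial P ℤ),
      restrict (Fin.succOrderEmb m) (map (evalScalar P) z)
        = map (evalScalar P) (restrict (Fin.succOrderEmb m) z) := fun z => rfl
  rw [← map_lift x, ← map_dp, h, h, h', ← map_dp, ← map_mul]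
  congr 1
  refine eq_of_nsmul_eq (i + 1).factorial_ne_zero ?_
  rw [← LinearMap.map_smul_of_tower, factorial_nsmul_dp hx.lift h0, contract_pow hx.lift hn,
    ← factorial_nsmul_dp (hx.lift.restrict _) h0, mul_smul_comm, ← mul_smul,
    Nat.factorial_succ]

/-! ### Forms killed by face maps -/

section Vanishing

/-- The coefficients do not involve the variable `a`. -/
def Avoids (x : Grassmann ι P) (a : ι) : Prop := ∀ S, a ∈ S → x S = 0

theorem Avoids.mul {x y : Grassmann ι P} {a : ι} (hx : Avoids x a) (hy : Avoids y a) :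
    Avoids (x * y) a := fun U hU => by
  rw [mul_apply]
  refine Finset.sum_eq_zero fun S _ => ?_
  by_cases h : a ∈ S
  · rw [hx S h, zero_mul, mul_zero]
  · rw [hy _ (Finset.mem_sdiff.2 ⟨hU, h⟩), mul_zero, mul_zero]

theorem avoids_one (a : ι) : Avoids (1 : Grassmann ι P) a := fun S hS => by
  rw [one_apply, if_neg]
  rintro rfl
  simp at hS

theorem Avoids.dp [Fintype ι] {x : Grassmann ι P} {a : ι} (hx : Avoids x a) {n : ℕ}
    (hd : HasDegree x n) (h0 : 0 < n) (i : ℕ) : Avoids (dp n i x) a := fun S hS => by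
  have hl : Avoids (lift x) a := fun S hS => lift_eq_zero (hx S hS)
  have hp : Avoids (lift x ^ i) a := by
    induction i with
    | zero => exact pow_zero (lift x) ▸ avoids_one a
    | succ i ih => exact pow_succ (lift x) i ▸ ih.mul hl
  rw [← map_lift x, ← map_dp, map_apply]
  have h := congrFun (factorial_nsmul_dp hd.lift h0 i) S
  rw [hp S hS, nsmul_apply] at h
  rw [(smul_eq_zero.1 h).resolve_left i.factorial_ne_zero, map_zero]

/-- The form depends on `a` and `b` only through their sum. -/
def Merges (x : Grassmann ι P) (a b : ι) : Prop :=
  (∀ S, a ∈ S → b ∈ S → x S = 0) ∧ ∀ S, x (S.map (Equiv.swap a b).toEmbedding) = x S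

theorem Merges.swapHom_eq {x : Grassmann ι P} {a b : ι} (hx : Merges x a b) (hab : a ⋖ b) :
    swapHom hab x = x := by
  ext S
  rw [swapHom_apply, hx.2, swapSign]
  split_ifs with h
  · rw [hx.1 S h.1 h.2, mul_zero]
  · simp

theorem Merges.lift {x : Grassmann ι P} {a b : ι} (hx : Merges x a b) : Merges (lift x) a b :=
  ⟨fun S ha hb => lift_eq_zero (hx.1 S ha hb), fun S => congrArg liftScalar (hx.2 S)⟩

/-- The lifts are fixed by the ring automorphism exchanging `a` and `b`, hence so is their product,
and a fixed form over a characteristic zero domain has no term containing both variables. -/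
theorem Merges.mul_eq_zero {x y : Grassmann ι P} {a b : ι} (hab : a ⋖ b) (hx : Merges x a b)
    (hy : Merges y a b) {S : Finset ι} (ha : a ∈ S) (hb : b ∈ S) : (x * y) S = 0 := by
  rw [← map_lift x, ← map_lift y, ← map_mul, map_apply,
    apply_eq_zero_of_swapHom_eq (x := Grassmann.lift x * Grassmann.lift y) hab ?_ ha hb, map_zero]
  rw [map_mul, hx.lift.swapHom_eq hab, hy.lift.swapHom_eq hab]

theorem Merges.dp_eq_zero [Fintype ι] {x : Grassmann ι P} {a b : ι} (hab : a ⋖ b)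
    (hx : Merges x a b) {n : ℕ} (hd : HasDegree x n) (h0 : 0 < n) (i : ℕ)
    {S : Finset ι} (ha : a ∈ S) (hb : b ∈ S) : dp n i x S = 0 := by
  rw [← map_lift x, ← map_dp, map_apply,
    apply_eq_zero_of_swapHom_eq (x := dp n i (Grassmann.lift x)) hab ?_ ha hb, map_zero]
  refine eq_of_nsmul_eq i.factorial_ne_zero ?_
  rw [← map_nsmul, factorial_nsmul_dp hd.lift h0, map_pow, hx.lift.swapHom_eq hab]

end Vanishing

end Grassmann

/-! ### Signs of shuffles -/

namespace Grassmann

section Monomial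

variable {ι : Type*} [LinearOrder ι] {P : Type*} [CommRing P]

theorem single_mul_single {a : ι} {S : Finset ι} (h : ∀ s ∈ S, a < s) :
    (single {a} 1 * single S 1 : Grassmann ι P) = single (insert a S) 1 := by
  have ha : a ∉ S := fun h' => lt_irrefl a (h a h')
  have hs : insert a S \ {a} = S := by
    rw [Finset.insert_sdiff_of_mem _ (Finset.mem_singleton_self a),
      Finset.sdiff_singleton_eq_erase, Finset.erase_eq_of_notMem ha]
  ext U
  rw [mul_apply]
  by_cases hU : U = insert a S
  · subst hU
    rw [Finset.sum_eq_single {a}]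
    · rw [hs, ← insert_empty_eq, shuffleSign_insert_left (by simp) _ h]
      simp [single]
    · intro V _ hV
      simp [single, hV]
    · simp
  · rw [single, if_neg hU]
    refine Finset.sum_eq_zero fun V hV => ?_
    by_cases hVa : V = {a}
    · rw [single, single, if_neg (c := U \ V = S), mul_zero, mul_zero]
      rintro rfl
      refine hU ?_
      rw [Finset.insert_eq, ← hVa, Finset.union_sdiff_of_subset (Finset.mem_powerset.1 hV)]
    · rw [single, if_neg hVa, zero_mul, mul_zero]

/-- The product of the variables `g 0`, `g 1`, …, in this order. -/
def monomial (P : Type*) [CommRing P] {r : ℕ} (g : Fin r → ι) : Grassmann ι P :=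
  (List.ofFn fun j => single {g j} 1).prod

theorem monomial_eq_single {r : ℕ} {g : Fin r → ι} (hg : StrictMono g) :
    monomial P g = single (Finset.univ.image g) 1 := by
  induction r with
  | zero =>
    ext S
    simp [monomial, one_apply, single]
  | succ r ih =>
    have h := ih (g := fun j => g j.succ) (hg.comp (Fin.strictMono_succ))
    rw [monomial] at h ⊢
    rw [List.ofFn_succ, List.prod_cons, h, single_mul_single]
    · congr 1
      ext a
      simp [Fin.exists_fin_succ, eq_comm]
    · simp only [Finset.mem_image, Finset.mem_univ, true_and, forall_exists_index,
        forall_apply_eq_imp_iff]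
      exact fun j => hg (Fin.succ_pos j)

/-- The monomials as an alternating function of the variables. -/
def alternatingMonomial (ι P : Type*) [LinearOrder ι] [Fintype ι] [CommRing P] (r : ℕ) :
    (ι → P) [⋀^Fin r]→ₗ[P] Grassmann ι P :=
  -- Linear forms have odd degree one, so they square to zero and the universal property of the
  -- exterior algebra applies. The signs of permutations are imported from there.
  (ExteriorAlgebra.lift P ⟨∑ j, (LinearMap.proj j : (ι → P) →ₗ[P] P).smulRight (single {j} 1),
    fun v => HasDegree.mul_self (n := 1) (fun S hS => by
      rw [LinearMap.sum_apply, sum_apply]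
      refine Finset.sum_eq_zero fun j _ => ?_
      rw [LinearMap.smulRight_apply, smul_apply, hasDegree_single _ _ _ hS, mul_zero])
      odd_one⟩).toLinearMap.compAlternatingMap (ExteriorAlgebra.ιMulti P r)

theorem alternatingMonomial_apply [Fintype ι] {r : ℕ} (g : Fin r → ι) :
    alternatingMonomial ι P r (fun j => Pi.single (g j) 1) = monomial P g := by
  rw [alternatingMonomial, LinearMap.compAlternatingMap_apply, ExteriorAlgebra.ιMulti_apply,
    AlgHom.toLinearMap_apply, map_list_prod, List.map_ofFn, monomial]
  congr 2
  funext j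
  rw [Function.comp_apply, ExteriorAlgebra.lift_ι_apply, LinearMap.sum_apply,
    Finset.sum_eq_single (g j)]
  · simp
  · intro i _ hi
    simp [hi]
  · simp

theorem monomial_comp_perm [Fintype ι] {r : ℕ} (g : Fin r → ι) (σ : Equiv.Perm (Fin r)) :
    monomial P (g ∘ σ) = (Equiv.Perm.sign σ : ℤ) • monomial P g := by
  rw [← alternatingMonomial_apply, ← alternatingMonomial_apply]
  exact (alternatingMonomial ι P r).map_perm (fun j => Pi.single (g j) 1) σ

theorem monomial_eq_zero [Fintype ι] {r : ℕ} {g : Fin r → ι} (hg : ¬ Function.Injective g) :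
    monomial P g = 0 := by
  rw [← alternatingMonomial_apply]
  obtain ⟨i, j, hij, hne⟩ := Function.not_injective_iff.1 hg
  exact (alternatingMonomial ι P r).map_eq_zero_of_eq _ (by rw [hij]) hne

theorem monomial_perm_apply_univ {r : ℕ} (σ : Equiv.Perm (Fin r)) :
    monomial P σ Finset.univ = ((Equiv.Perm.sign σ : ℤ) : P) := by
  have h := monomial_comp_perm (P := P) id σ
  rw [Function.id_comp, monomial_eq_single strictMono_id] at h
  rw [h]
  simp [single]

/-- A monomial with a repeated variable vanishes, so only bijective `f` contribute, each with its
sign. -/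
theorem sum_mul_monomial_apply_univ {r : ℕ} (G : (Fin r → Fin r) → P) :
    ∑ f, G f * monomial P f Finset.univ
      = ∑ σ : Equiv.Perm (Fin r), (Equiv.Perm.sign σ : ℤ) • G σ := by
  symm
  refine Finset.sum_of_injOn (fun σ => ⇑σ) (DFunLike.coe_injective.injOn) (by simp) ?_ ?_
  · intro f _ hf
    rw [monomial_eq_zero, zero_apply, mul_zero]
    intro hi
    exact hf ⟨Equiv.ofBijective f (Finite.injective_iff_bijective.1 hi), by simp, rfl⟩
  · intro σ _
    rw [monomial_perm_apply_univ, zsmul_eq_mul, mul_comm]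

theorem monomial_append {p q : ℕ} (g : Fin p → ι) (h : Fin q → ι) :
    monomial P (Fin.append g h) = monomial P g * monomial P h := by
  rw [monomial, monomial, monomial, ← List.prod_append, ← List.ofFn_fin_append]
  congr 2
  funext j
  refine Fin.addCases (fun j => ?_) (fun j => ?_) j <;> simp

theorem monomial_blocks {i n : ℕ} (f : Fin (i * n) → ι) :
    monomial P f
      = (List.ofFn fun j : Fin i =>
          monomial P fun x : Fin n => f (finProdFinEquiv (j, x))).prod := by
  rw [monomial, List.ofFn_mul, List.prod_flatten, List.map_ofFn]
  congr 2
  funext j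
  rw [Function.comp_apply, monomial]
  congr 3
  funext x
  congr 3
  apply Fin.ext
  simp [finProdFinEquiv, mul_comm, add_comm]

open Classical in
-- The sum runs over all functions, with weight zero off the increasing ones, so that a product of
-- such sums is reindexed by functions on the concatenated index set.
theorem HasDegree.eq_sum_monomial [Fintype ι] {x : Grassmann ι P} {n : ℕ} (hx : HasDegree x n) :
    x = ∑ g : Fin n → ι,
      (if StrictMono g then x (Finset.univ.image g) else 0) • monomial P g := by
  ext S
  rw [sum_apply]
  by_cases hS : S.card = n
  · rw [Finset.sum_eq_single ⇑(S.orderEmbOfFin hS)]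
    · rw [if_pos (S.orderEmbOfFin hS).strictMono, smul_apply,
        monomial_eq_single (S.orderEmbOfFin hS).strictMono, Finset.image_orderEmbOfFin_univ, single,
        if_pos rfl, mul_one]
    · intro g _ hg
      rw [smul_apply]
      split_ifs with h
      · rw [monomial_eq_single h, single, if_neg, mul_zero]
        intro hgS
        exact hg (Finset.orderEmbOfFin_unique hS (fun j => by simp [hgS]) h)
      · rw [zero_mul]
    · simp
  · rw [hx S hS, Finset.sum_eq_zero]
    intro g _
    rw [smul_apply]
    split_ifs with h
    · rw [monomial_eq_single h, single, if_neg, mul_zero]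
      rintro rfl
      exact hS (by rw [Finset.card_image_of_injective _ h.injective, Finset.card_univ,
        Fintype.card_fin])
    · rw [zero_mul]

end Monomial

theorem sum_pow_eq_sum_prod_ofFn {B α : Type*} [Ring B] [Fintype α] (z : α → B) (i : ℕ) :
    (∑ a, z a) ^ i = ∑ G : Fin i → α, (List.ofFn fun j => z (G j)).prod := by
  induction i with
  | zero => simp
  | succ i ih =>
    rw [pow_succ', ih, ← (Fin.consEquiv fun _ => α).sum_comp, Fintype.sum_prod_type,
      Finset.sum_mul_sum]
    refine Finset.sum_congr rfl fun a _ => Finset.sum_congr rfl fun G _ => ?_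
    rw [List.ofFn_succ, List.prod_cons]
    rfl

theorem prod_ofFn_smul {B P : Type*} [CommRing P] [Ring B] [Algebra P B] {i : ℕ} (c : Fin i → P)
    (z : Fin i → B) : (List.ofFn fun j => c j • z j).prod = (∏ j, c j) • (List.ofFn z).prod := by
  induction i with
  | zero => simp
  | succ i ih =>
    rw [List.ofFn_succ, List.prod_cons, ih, List.ofFn_succ, List.prod_cons, Fin.prod_univ_succ,
      smul_mul_smul_comm]

/-! ### Top coefficients as sums over shuffles -/

section Shuffles

variable {P : Type*} [CommRing P]

open Classical in
theorem mul_apply_univ {p q : ℕ} {x y : Grassmann (Fin (p + q)) P} (hx : HasDegree x p)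
    (hy : HasDegree y q) : (x * y) Finset.univ
      = ∑ σ : Equiv.Perm (Fin (p + q)) with IsShuffle p q σ, (Equiv.Perm.sign σ : ℤ) •
        (x (Finset.univ.image fun j => σ (Fin.castAdd q j)) *
          y (Finset.univ.image fun j => σ (Fin.natAdd p j))) := by
  have h : (x * y) Finset.univ = ∑ f : Fin (p + q) → Fin (p + q),
      (if StrictMono (fun j => f (Fin.castAdd q j)) ∧ StrictMono (fun j => f (Fin.natAdd p j))
        then x (Finset.univ.image fun j => f (Fin.castAdd q j)) *
          y (Finset.univ.image fun j => f (Fin.natAdd p j)) else 0) *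
        monomial P f Finset.univ := by
    conv_lhs => rw [hx.eq_sum_monomial, hy.eq_sum_monomial]
    rw [Finset.sum_mul_sum, ← Fintype.sum_prod_type', sum_apply,
      ← (Fin.appendEquiv p q).sum_comp]
    refine Finset.sum_congr rfl fun ⟨g, h⟩ _ => ?_
    rw [smul_mul_smul_comm, smul_apply]
    change _ = _ * monomial P (Fin.append g h) _
    rw [monomial_append]
    congr 1
    simp only [Fin.appendEquiv, Equiv.coe_fn_mk, Fin.append_left, Fin.append_right]
    by_cases h1 : StrictMono g <;> by_cases h2 : StrictMono h <;> simp [h1, h2]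
  rw [h, sum_mul_monomial_apply_univ, Finset.sum_filter]
  refine Finset.sum_congr rfl fun σ _ => ?_
  rw [smul_ite, smul_zero]
  exact if_congr Iff.rfl rfl rfl

/-- Permutations that increase on each of the `i` blocks of length `n`. -/
def IsBlockShuffle (n i : ℕ) (σ : Equiv.Perm (Fin (i * n))) : Prop :=
  ∀ j : Fin i, StrictMono fun x : Fin n => σ (finProdFinEquiv (j, x))

/-- The summand of the `i`-fold shuffle power for the permutation `σ`. -/
def shuffleTerm {n i : ℕ} (x : Grassmann (Fin (i * n)) P) (σ : Equiv.Perm (Fin (i * n))) : P :=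
  (Equiv.Perm.sign σ : ℤ) •
    ∏ j : Fin i, x (Finset.univ.image fun k : Fin n => σ (finProdFinEquiv (j, k)))

open Classical in
theorem pow_apply_univ {n i : ℕ} {x : Grassmann (Fin (i * n)) P} (hx : HasDegree x n) :
    (x ^ i) Finset.univ
      = ∑ σ : Equiv.Perm (Fin (i * n)) with IsBlockShuffle n i σ, shuffleTerm x σ := by
  have h : (x ^ i) Finset.univ = ∑ f : Fin (i * n) → Fin (i * n),
      (if ∀ j : Fin i, StrictMono fun k : Fin n => f (finProdFinEquiv (j, k))
        then ∏ j : Fin i, x (Finset.univ.image fun k : Fin n => f (finProdFinEquiv (j, k)))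
        else 0) * monomial P f Finset.univ := by
    conv_lhs => rw [hx.eq_sum_monomial]
    rw [sum_pow_eq_sum_prod_ofFn, sum_apply,
      ← ((finProdFinEquiv.arrowCongr (Equiv.refl (Fin (i * n)))).symm.trans
        (Equiv.curry (Fin i) (Fin n) (Fin (i * n)))).sum_comp]
    refine Finset.sum_congr rfl fun f _ => ?_
    rw [prod_ofFn_smul, smul_apply, monomial_blocks]
    congr 1
    change ∏ j : Fin i, (if StrictMono (fun k : Fin n => f (finProdFinEquiv (j, k)))
      then x (Finset.univ.image fun k : Fin n => f (finProdFinEquiv (j, k))) else 0) = _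
    split_ifs with h
    · exact Finset.prod_congr rfl fun j _ => if_pos (h j)
    · obtain ⟨j, hj⟩ := not_forall.1 h
      exact Finset.prod_eq_zero (Finset.mem_univ j) (if_neg hj)
  rw [h, sum_mul_monomial_apply_univ, Finset.sum_filter]
  refine Finset.sum_congr rfl fun σ _ => ?_
  rw [smul_ite, smul_zero]
  exact if_congr Iff.rfl rfl rfl

/-- The permutation of `i` blocks of length `n`. -/
def blockPerm (n : ℕ) {i : ℕ} (τ : Equiv.Perm (Fin i)) : Equiv.Perm (Fin (i * n)) :=
  finProdFinEquiv.permCongr (Equiv.prodCongrLeft fun _ : Fin n => τ)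

theorem blockPerm_apply {n i : ℕ} (τ : Equiv.Perm (Fin i)) (j : Fin i) (k : Fin n) :
    blockPerm n τ (finProdFinEquiv (j, k)) = finProdFinEquiv (τ j, k) := by
  simp [blockPerm, Equiv.permCongr_apply, Equiv.prodCongrLeft]

/-- Moving blocks by `τ` amounts to `n` disjoint copies of `τ`, so the sign is an even power of that
of `τ`. -/
theorem sign_blockPerm {n i : ℕ} (hn : Even n) (τ : Equiv.Perm (Fin i)) :
    Equiv.Perm.sign (blockPerm n τ) = 1 := by
  rw [blockPerm, Equiv.Perm.sign_permCongr, Equiv.Perm.sign_prodCongrLeft, Finset.prod_const,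
    Finset.card_univ, Fintype.card_fin, Int.units_pow_eq_pow_mod_two, Nat.even_iff.1 hn, pow_zero]

theorem shuffleTerm_mul_blockPerm {n i : ℕ} (hn : Even n) (x : Grassmann (Fin (i * n)) P)
    (σ : Equiv.Perm (Fin (i * n))) (τ : Equiv.Perm (Fin i)) :
    shuffleTerm x (σ * blockPerm n τ) = shuffleTerm x σ := by
  rw [shuffleTerm, shuffleTerm, map_mul, sign_blockPerm hn, mul_one]
  simp only [Equiv.Perm.mul_apply, blockPerm_apply]
  congr 1
  exact Equiv.prod_comp τ fun j => x (Finset.univ.image fun k : Fin n => σ (finProdFinEquiv (j, k)))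

theorem isBlockShuffle_mul_blockPerm {n i : ℕ} (σ : Equiv.Perm (Fin (i * n)))
    (τ : Equiv.Perm (Fin i)) :
    IsBlockShuffle n i (σ * blockPerm n τ) ↔ IsBlockShuffle n i σ := by
  simp only [IsBlockShuffle, Equiv.Perm.mul_apply, blockPerm_apply]
  exact τ.forall_congr_left.trans (by simp)

theorem existsUnique_strictMono_comp {i : ℕ} {α : Type*} [LinearOrder α] {f : Fin i → α}
    (hf : Function.Injective f) : ∃! τ : Equiv.Perm (Fin i), StrictMono (f ∘ τ) := by
  refine ⟨Tuple.sort f, (Tuple.monotone_sort f).strictMono_of_injective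
    (hf.comp (Tuple.sort f).injective), fun τ hτ => ?_⟩
  have h : f ∘ τ = f ∘ Tuple.sort f := Tuple.unique_monotone hτ.monotone (Tuple.monotone_sort f)
  ext j
  exact congrArg Fin.val (hf (congrFun h j))

open Classical in
-- The summand is invariant under permutation of the blocks, and sorting the blocks by the values at
-- their first elements picks exactly one representative per orbit; every orbit has `i!` elements.
theorem factorial_nsmul_sum_shuffleTerm {n i : ℕ} (hn : Even n) (h0 : 0 < n)
    (x : Grassmann (Fin (i * n)) P) :
    i.factorial • ∑ σ : Equiv.Perm (Fin (i * n)) with IsShuffleRep n i h0 σ, shuffleTerm x σ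
      = ∑ σ : Equiv.Perm (Fin (i * n)) with IsBlockShuffle n i σ, shuffleTerm x σ := by
  have h1 : ∀ τ : Equiv.Perm (Fin i),
      ∑ σ : Equiv.Perm (Fin (i * n)) with IsShuffleRep n i h0 (σ * blockPerm n τ), shuffleTerm x σ
      = ∑ σ : Equiv.Perm (Fin (i * n)) with IsShuffleRep n i h0 σ, shuffleTerm x σ := fun τ => by
    rw [Finset.sum_filter, Finset.sum_filter,
      ← Equiv.sum_comp (Equiv.mulRight (blockPerm n τ)) fun σ =>
        if IsShuffleRep n i h0 σ then shuffleTerm x σ else 0]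
    refine Finset.sum_congr rfl fun σ _ => ?_
    rw [Equiv.coe_mulRight, shuffleTerm_mul_blockPerm hn]
  have h2 : i.factorial • ∑ σ : Equiv.Perm (Fin (i * n)) with IsShuffleRep n i h0 σ,
      shuffleTerm x σ = ∑ τ : Equiv.Perm (Fin i), ∑ σ : Equiv.Perm (Fin (i * n)) with
        IsShuffleRep n i h0 (σ * blockPerm n τ), shuffleTerm x σ := by
    rw [Finset.sum_congr rfl fun τ _ => h1 τ, Finset.sum_const, Finset.card_univ,
      Fintype.card_perm, Fintype.card_fin]
  rw [h2]
  simp only [Finset.sum_filter]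
  rw [Finset.sum_comm]
  refine Finset.sum_congr rfl fun σ _ => ?_
  have hrep : ∀ τ, IsShuffleRep n i h0 (σ * blockPerm n τ) ↔ IsBlockShuffle n i σ ∧
      StrictMono ((fun j : Fin i => σ (finProdFinEquiv (j, ⟨0, h0⟩))) ∘ τ) := fun τ => by
    rw [← isBlockShuffle_mul_blockPerm σ τ]
    simp only [IsShuffleRep, IsBlockShuffle, Equiv.Perm.mul_apply, blockPerm_apply]
    rfl
  simp only [hrep]
  by_cases h : IsBlockShuffle n i σ
  · have hinj : Function.Injective fun j : Fin i => σ (finProdFinEquiv (j, ⟨0, h0⟩)) :=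
      fun j k hjk => congrArg Prod.fst (finProdFinEquiv.injective (σ.injective hjk))
    obtain ⟨τ, hτ, hu⟩ := existsUnique_strictMono_comp hinj
    rw [if_pos h, Finset.sum_eq_single τ]
    · rw [if_pos ⟨h, hτ⟩]
    · intro τ' _ hne
      rw [if_neg]
      exact fun h' => hne (hu τ' h'.2)
    · simp
  · simp [h]

open Classical in
-- Both sides become the top coefficient of the `i`-th power after multiplication by `i!`, which may
-- be cancelled for the lift.
theorem dp_apply_univ {n i : ℕ} (h0 : 0 < n) {x : Grassmann (Fin (i * n)) P} (hx : HasDegree x n)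
    (hn : Even n) : dp n i x Finset.univ
      = ∑ σ : Equiv.Perm (Fin (i * n)) with IsShuffleRep n i h0 σ, shuffleTerm x σ := by
  have key : dp n i (lift x) Finset.univ
      = ∑ σ : Equiv.Perm (Fin (i * n)) with IsShuffleRep n i h0 σ, shuffleTerm (lift x) σ := by
    refine smul_right_injective _ i.factorial_ne_zero ?_
    change i.factorial • _ = i.factorial • _
    rw [factorial_nsmul_sum_shuffleTerm hn h0, ← pow_apply_univ hx.lift,
      ← factorial_nsmul_dp hx.lift h0, nsmul_apply]
  have h := congrArg (evalScalar P) key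
  rw [← map_apply, map_dp, map_lift] at h
  rw [h, map_sum]
  refine Finset.sum_congr rfl fun σ _ => ?_
  rw [shuffleTerm, map_zsmul, map_prod, shuffleTerm]
  congr 1
  exact Finset.prod_congr rfl fun j _ => evalScalar_liftScalar _

end Shuffles

end Grassmann

/-! ### The forms attached to simplices -/

namespace Grassmann

section Hat

variable {R : Type u} [CommRing R] (X : SimplicialObject (CommAlgCat.{w} R))

/-- The ring homomorphism induced by a monotone map. -/
def pull {m n : ℕ} (f : Fin (m + 1) →o Fin (n + 1)) : X _⦋n⦌ →ₐ[R] X _⦋m⦌ :=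
  (X.map (SimplexCategory.mkHom f).op).hom

theorem pull_pull {l m n : ℕ} (f : Fin (l + 1) →o Fin (m + 1)) (g : Fin (m + 1) →o Fin (n + 1))
    (a : X _⦋n⦌) : pull X f (pull X g a) = pull X (g.comp f) a := by
  have h := X.map_comp (SimplexCategory.mkHom g).op (SimplexCategory.mkHom f).op
  exact (congrArg (fun φ => φ.hom a) h).symm

theorem pull_id {n : ℕ} (a : X _⦋n⦌) : pull X OrderHom.id a = a :=
  congrArg (fun φ => φ.hom a) (X.map_id (op ⦋n⦌))

theorem degeneracyOff_eq_pull {n m : ℕ} (g : Fin n → Fin m) :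
    degeneracyOff X g = pull X (countBelow g) := rfl

/-- The face maps as ring homomorphisms. -/
def faceHom {m : ℕ} (i : Fin (m + 2)) : X _⦋m + 1⦌ →+* X _⦋m⦌ := (X.δ i).hom.toRingHom

variable {X}

/-- A monotone map that misses the vertex `i` factors through the `i`-th coface, and `d_i` kills
normalized simplices for `i > 0`. -/
theorem pull_eq_zero_of_ne {m n : ℕ} (f : Fin (m + 1) →o Fin (n + 1)) (i : Fin (n + 1))
    (hi : 0 < i) (hf : ∀ k, f k ≠ i) {a : X _⦋n⦌} (ha : a ∈ normalizedModule X n) :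
    pull X f a = 0 := by
  cases n with
  | zero => exact absurd hi (by simp)
  | succ n =>
    obtain ⟨j, rfl⟩ := Fin.exists_succ_eq.2 hi.ne'
    obtain ⟨θ, hθ⟩ := SimplexCategory.eq_comp_δ_of_not_surjective' (SimplexCategory.mkHom f)
      j.succ hf
    have h : pull X f a = (X.map θ.op).hom ((X.δ j.succ).hom a) := by
      rw [pull, hθ, op_comp, X.map_comp]
      rfl
    rw [h, mem_normalizedModule_succ.1 ha, map_zero]

theorem degeneracyOff_degeneracyOff {n m l : ℕ} (g : Fin n → Fin m) (h : Fin m → Fin l)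
    (hh : Monotone h) (a : X _⦋n⦌) :
    degeneracyOff X h (degeneracyOff X g a) = degeneracyOff X (h ∘ g) a := by
  rw [degeneracyOff_eq_pull, degeneracyOff_eq_pull, pull_pull, degeneracyOff_eq_pull]
  congr 2
  exact OrderHom.ext _ _ (countBelow_comp g h hh).symm

theorem degeneracyOff_id {n : ℕ} (a : X _⦋n⦌) : degeneracyOff X (id : Fin n → Fin n) a = a := by
  rw [degeneracyOff_eq_pull, show countBelow (id : Fin n → Fin n) = OrderHom.id from
    OrderHom.ext _ _ (countBelow_id n), pull_id]

/-- The form in `m` variables whose coefficients are the degeneracies of `a`. -/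
def hat {p : ℕ} (m : ℕ) (a : X _⦋p⦌) : Grassmann (Fin m) (X _⦋m⦌) :=
  fun S => if h : S.card = p then degeneracyOff X (S.orderEmbOfFin h) a else 0

variable {p q n m : ℕ}

theorem hat_image {g : Fin p → Fin m} (hg : StrictMono g) (a : X _⦋p⦌) :
    hat m a (Finset.univ.image g) = degeneracyOff X g a := by
  have hc : (Finset.univ.image g).card = p := by
    rw [Finset.card_image_of_injective _ hg.injective, Finset.card_univ, Fintype.card_fin]
  rw [hat, dif_pos hc]
  congr 2
  exact (Finset.orderEmbOfFin_unique hc (fun j => by simp) hg).symm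

theorem eq_image_of_card {S : Finset (Fin m)} (hS : S.card = p) :
    ∃ g : Fin p ↪o Fin m, S = Finset.univ.image g :=
  ⟨S.orderEmbOfFin hS, (Finset.image_orderEmbOfFin_univ _ _).symm⟩

theorem hasDegree_hat (a : X _⦋p⦌) : HasDegree (hat m a) p := fun _ hS => dif_neg hS

theorem hat_apply_univ (a : X _⦋p⦌) : hat p a Finset.univ = a := by
  have h := hat_image (X := X) (strictMono_id (α := Fin p)) a
  rwa [Finset.image_id, degeneracyOff_id] at h

theorem hat_add (a b : X _⦋p⦌) : hat m (a + b) = hat m a + hat m b := by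
  ext S
  rw [add_apply, hat, hat, hat]
  split_ifs
  · exact map_add _ _ _
  · rw [add_zero]

theorem hat_smul (r : R) (a : X _⦋p⦌) : hat m (r • a) = algebraMap R (X _⦋m⦌) r • hat m a := by
  ext S
  rw [smul_apply, hat, hat]
  split_ifs
  · rw [_root_.map_smul, Algebra.smul_def]
  · rw [mul_zero]

theorem hat_degree_zero (a : X _⦋0⦌) :
    hat m a = degeneracyOff X (Fin.elim0 : Fin 0 → Fin m) a • (1 : Grassmann (Fin m) (X _⦋m⦌)) := by
  ext S
  rw [smul_apply, one_apply]
  by_cases hS : S = ∅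
  · subst hS
    rw [if_pos rfl, mul_one]
    exact hat_image (g := (Fin.elim0 : Fin 0 → Fin m)) (fun j => j.elim0) a
  · rw [if_neg hS, mul_zero, hasDegree_hat a S (by simpa using hS)]

theorem hat_one : hat m (1 : X _⦋0⦌) = 1 := by
  rw [hat_degree_zero, map_one, one_smul]

/-- Families of forms that are compatible with degeneracies. -/
def Coherent (y : ∀ m, Grassmann (Fin m) (X _⦋m⦌)) : Prop :=
  ∀ (u m : ℕ) (g : Fin u ↪o Fin m),
    map (degeneracyOff X g : X _⦋u⦌ →+* X _⦋m⦌) (y u) = restrict g (y m)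

theorem coherent_hat (a : X _⦋p⦌) : Coherent fun m => hat m a := fun u m g => by
  ext S
  rw [map_apply, restrict_apply]
  change degeneracyOff X g (hat u a S) = hat m a (S.map g.toEmbedding)
  by_cases hS : S.card = p
  · obtain ⟨h, rfl⟩ := eq_image_of_card hS
    have e : (Finset.univ.image h).map g.toEmbedding = Finset.univ.image (g ∘ h) := by
      ext
      simp
    rw [e, hat_image h.strictMono, hat_image (g.strictMono.comp h.strictMono)]
    exact degeneracyOff_degeneracyOff h g g.monotone a
  · rw [hasDegree_hat a S hS, map_zero, hasDegree_hat a _ (by rwa [Finset.card_map])]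

theorem Coherent.mul {y z : ∀ m, Grassmann (Fin m) (X _⦋m⦌)} (hy : Coherent y) (hz : Coherent z) :
    Coherent fun m => y m * z m := fun _ _ g => by
  rw [map_mul, map_mul, hy, hz]

theorem Coherent.dp {y : ∀ m, Grassmann (Fin m) (X _⦋m⦌)} (hy : Coherent y) {n : ℕ}
    (hd : ∀ m, HasDegree (y m) n) (h0 : 0 < n) (i : ℕ) :
    Coherent fun m => dp n i (y m) := fun _ _ g => by
  rw [map_dp, restrict_dp (hd _) h0, hy]

/-- Apply compatibility to the increasing enumeration of `S`: the coefficient at `S` is a degeneracy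
of the top coefficient in `n` variables. -/
theorem Coherent.eq_hat {y : ∀ m, Grassmann (Fin m) (X _⦋m⦌)} (hy : Coherent y) {n : ℕ}
    (hd : ∀ m, HasDegree (y m) n) (m : ℕ) : hat m (y n Finset.univ) = y m := by
  ext S
  by_cases hS : S.card = n
  · obtain ⟨g, rfl⟩ := eq_image_of_card hS
    rw [hat_image g.strictMono]
    have h := congrFun (hy _ _ g) Finset.univ
    rw [map_apply, restrict_apply, Finset.map_eq_image] at h
    exact h
  · rw [hd m S hS, hasDegree_hat _ S hS]

/-- Multiplicativity of `hat`: identities for iterated shuffle products reduce to identities between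
forms. -/
theorem hat_mul_univ (h : p + q = n) (a : X _⦋p⦌) (b : X _⦋q⦌) (m : ℕ) :
    hat m ((hat n a * hat n b) Finset.univ) = hat m a * hat m b :=
  ((coherent_hat a).mul (coherent_hat b)).eq_hat
    (fun _ => (hasDegree_hat a).mul (hasDegree_hat b) h) m

theorem hat_dp_univ (h0 : 0 < n) {i k : ℕ} (h : n * i = k) (a : X _⦋n⦌) (m : ℕ) :
    hat m (dp n i (hat k a) Finset.univ) = dp n i (hat m a) := by
  subst h
  exact ((coherent_hat a).dp (fun _ => hasDegree_hat a) h0 i).eq_hat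
    (fun _ => (hasDegree_hat a).dp h0 i) m

/-! ### Faces -/

/-- If `0` is not in `S`, the degeneracy identifies the vertices `0` and `1`; `d_0` undoes this and
the other indices shift down by one. -/
theorem restrict_map_δ_zero_hat (a : X _⦋p⦌) :
    restrict (Fin.succOrderEmb m) (map (faceHom X 0) (hat (m + 1) a))
      = hat m a := by
  ext S
  rw [restrict_apply, map_apply]
  by_cases hS : S.card = p
  · obtain ⟨g, rfl⟩ := eq_image_of_card hS
    have e : (Finset.univ.image g).map (Fin.succOrderEmb m).toEmbedding
        = Finset.univ.image (Fin.succ ∘ g) := by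
      ext
      simp
    rw [e, hat_image g.strictMono, hat_image ((Fin.strictMono_succ).comp g.strictMono)]
    refine (pull_pull X _ _ a).trans ?_
    rw [degeneracyOff_eq_pull]
    congr 2
    ext k
    simp [countBelow, Fin.lt_def]
  · rw [hasDegree_hat a S hS, hasDegree_hat a _ (by rwa [Finset.card_map]), map_zero]

/-- If `0` is in `S`, the vertices `0` and `1` stay distinct, so `d_0` passes the degeneracies and
acts on `a` itself. -/
theorem contract_map_δ_zero_hat (a : X _⦋p + 1⦌) :
    contract (map (faceHom X 0) (hat (m + 1) a))
      = hat m ((X.δ 0).hom a) := by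
  ext S
  rw [contract_apply, map_apply]
  by_cases hS : S.card = p
  · obtain ⟨g, rfl⟩ := eq_image_of_card hS
    have e : insert 0 ((Finset.univ.image g).map (Fin.succOrderEmb m).toEmbedding)
        = Finset.univ.image (Fin.cons 0 (Fin.succ ∘ g) : Fin (p + 1) → Fin (m + 1)) := by
      ext
      simp [Fin.exists_fin_succ, eq_comm]
    have hs : StrictMono (Fin.cons 0 (Fin.succ ∘ g) : Fin (p + 1) → Fin (m + 1)) := by
      intro i j hij
      obtain ⟨j, rfl⟩ := Fin.exists_succ_eq.2 (i.zero_le.trans_lt hij).ne'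
      refine Fin.cases (fun _ => ?_) (fun i hij => ?_) i hij
      · simp
      · simpa using hij
    rw [e, hat_image g.strictMono, hat_image hs]
    refine (pull_pull X _ _ a).trans ((congrArg (pull X · a) ?_).trans (pull_pull X _ _ a).symm)
    ext k
    change (Finset.univ.filter fun x : Fin (p + 1) =>
      ((Fin.cons 0 (Fin.succ ∘ g) : Fin (p + 1) → Fin (m + 1)) x).castSucc
        < Fin.succAbove 0 k).card
      = (Fin.succAbove 0 (countBelow g k)).val
    rw [Fin.card_filter_univ_succ, if_pos (by simp [Fin.lt_def])]
    simp [countBelow, Fin.lt_def]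
  · rw [hasDegree_hat _ S hS, hasDegree_hat a _, map_zero]
    rw [Finset.card_insert_of_notMem (zero_notMem_map_succ S), Finset.card_map]
    omega

theorem contract_map_δ_zero_hat_degree_zero (a : X _⦋0⦌) :
    contract (map (faceHom X 0) (hat (m + 1) a)) = 0 := by
  ext S
  rw [contract_apply, map_apply, hasDegree_hat a, map_zero, zero_apply]
  rw [Finset.card_insert_of_notMem (zero_notMem_map_succ S)]
  omega

theorem countBelow_lt_of_succ_eq {g : Fin n → Fin m} {x : Fin n} {k i : Fin (m + 1)}
    (hx : (g x).succ = i) (hk : k < i) : countBelow g k < countBelow g i := by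
  refine Fin.lt_def.2 (Finset.card_lt_card
    (s := Finset.univ.filter fun x => (g x).castSucc < k)
    (t := Finset.univ.filter fun x => (g x).castSucc < i) ⟨fun y hy => ?_, fun h => ?_⟩)
  · simp only [Finset.mem_filter, Finset.mem_univ, true_and] at hy ⊢
    exact hy.trans hk
  · have := h (Finset.mem_filter.2 ⟨Finset.mem_univ x, by subst hx; exact Fin.castSucc_lt_succ⟩)
    simp only [Finset.mem_filter, Finset.mem_univ, true_and] at this
    subst hx
    simp only [Fin.lt_def, Fin.val_succ, Fin.val_castSucc] at this hk
    omega

theorem countBelow_lt_of_castSucc_eq {g : Fin n → Fin m} {x : Fin n} {k i : Fin (m + 1)}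
    (hx : (g x).castSucc = i) (hk : i < k) : countBelow g i < countBelow g k := by
  refine Fin.lt_def.2 (Finset.card_lt_card
    (s := Finset.univ.filter fun x => (g x).castSucc < i)
    (t := Finset.univ.filter fun x => (g x).castSucc < k) ⟨fun y hy => ?_, fun h => ?_⟩)
  · simp only [Finset.mem_filter, Finset.mem_univ, true_and] at hy ⊢
    exact hy.trans hk
  · have := h (Finset.mem_filter.2 ⟨Finset.mem_univ x, by subst hx; exact hk⟩)
    simp only [Finset.mem_filter, Finset.mem_univ, true_and] at this
    exact absurd this (by rw [hx]; exact lt_irrefl _)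

/-- If the last variable occurs in `S`, only the last vertex is sent to the top value. Omitting that
vertex leaves a map missing a positive vertex. -/
theorem avoids_map_δ_last_hat {a : X _⦋p⦌} (ha : a ∈ normalizedModule X p) :
    Avoids (map (faceHom X (Fin.last (m + 1))) (hat (m + 1) a))
      (Fin.last m) := fun S hm => by
  rw [map_apply]
  by_cases hS : S.card = p
  · obtain ⟨g, rfl⟩ := eq_image_of_card hS
    rw [hat_image g.strictMono]
    simp only [Finset.mem_image, Finset.mem_univ, true_and] at hm
    obtain ⟨x, hx⟩ := hm
    have hlt : ∀ k < Fin.last (m + 1), countBelow g k < countBelow g (Fin.last (m + 1)) :=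
      fun k hk => countBelow_lt_of_succ_eq (by rw [hx, Fin.succ_last]) hk
    refine (pull_pull X _ _ a).trans
      (pull_eq_zero_of_ne _ (countBelow g (Fin.last (m + 1))) ?_ ?_ ha)
    · exact (Fin.zero_le _).trans_lt (hlt 0 (Fin.last_pos))
    · intro k
      exact (hlt _ (lt_of_le_of_ne (Fin.le_last _) (Fin.succAbove_ne _ k))).ne
  · rw [hasDegree_hat a S hS, map_zero]

theorem countBelow_image_val {S : Finset (Fin m)} (hS : S.card = p) (k : Fin (m + 1)) :
    (countBelow (S.orderEmbOfFin hS) k).val = (S.filter fun s => s.castSucc < k).card := by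
  change (Finset.univ.filter fun x => (S.orderEmbOfFin hS x).castSucc < k).card = _
  conv_rhs => rw [← Finset.image_orderEmbOfFin_univ S hS, Finset.filter_image]
  rw [Finset.card_image_of_injective _ (S.orderEmbOfFin hS).injective]

/-- The only threshold separating `t` from `t + 1` is `t + 1`, and that is the vertex omitted by the
face `d_{t+1}`. -/
theorem card_filter_map_swap (S : Finset (Fin (m + 1))) (t : Fin m) {k : Fin (m + 2)}
    (hk : k ≠ t.succ.castSucc) :
    ((S.map (Equiv.swap t.castSucc t.succ).toEmbedding).filter fun s => s.castSucc < k).card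
      = (S.filter fun s => s.castSucc < k).card := by
  rw [Finset.filter_map, Finset.card_map]
  congr 1
  refine Finset.filter_congr fun s _ => ?_
  simp only [Function.comp_apply, Equiv.coe_toEmbedding, Equiv.swap_apply_def]
  simp only [ne_eq, Fin.ext_iff, Fin.val_castSucc, Fin.val_succ] at hk
  split_ifs with h1 h2
  · subst h1
    simp only [Fin.lt_def, Fin.val_castSucc, Fin.val_succ]
    omega
  · subst h2
    simp only [Fin.lt_def, Fin.val_castSucc, Fin.val_succ]
    omega
  · rfl

/-- If `t` and `t + 1` are both in `S`, the vertex `t + 1` is alone in its fibre, so omitting it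
gives a map missing a positive vertex. Exchanging `t` and `t + 1` changes the monotone map at most
at this omitted vertex. -/
theorem merges_map_δ_hat {a : X _⦋p⦌} (ha : a ∈ normalizedModule X p) (t : Fin m) :
    Merges (map (faceHom X t.succ.castSucc) (hat (m + 1) a))
      t.castSucc t.succ := by
  constructor
  · intro S h1 h2
    rw [map_apply]
    by_cases hS : S.card = p
    · obtain ⟨g, rfl⟩ := eq_image_of_card hS
      rw [hat_image g.strictMono]
      simp only [Finset.mem_image, Finset.mem_univ, true_and] at h1 h2
      obtain ⟨x, hx⟩ := h1
      obtain ⟨y, hy⟩ := h2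
      have hlt : ∀ k < t.succ.castSucc, countBelow g k < countBelow g t.succ.castSucc :=
        fun k hk => countBelow_lt_of_succ_eq (by rw [hx, Fin.succ_castSucc]) hk
      have hgt : ∀ k > t.succ.castSucc, countBelow g t.succ.castSucc < countBelow g k :=
        fun k hk => countBelow_lt_of_castSucc_eq (by rw [hy]) hk
      refine (pull_pull X _ _ a).trans
        (pull_eq_zero_of_ne _ (countBelow g t.succ.castSucc) ?_ ?_ ha)
      · exact (Fin.zero_le _).trans_lt (hlt 0 (by simp [Fin.lt_def]))
      · intro k
        rcases lt_or_gt_of_ne (Fin.succAbove_ne t.succ.castSucc k) with h | h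
        · exact (hlt _ h).ne
        · exact (hgt _ h).ne'
    · rw [hasDegree_hat a S hS, map_zero]
  · intro S
    rw [map_apply, map_apply]
    by_cases hS : S.card = p
    · have hS' : (S.map (Equiv.swap t.castSucc t.succ).toEmbedding).card = p := by
        rwa [Finset.card_map]
      rw [hat, hat, dif_pos hS, dif_pos hS']
      refine (pull_pull X _ _ a).trans ((congrArg (pull X · a) ?_).trans (pull_pull X _ _ a).symm)
      ext k
      refine (countBelow_image_val hS' _).trans (Eq.trans ?_ (countBelow_image_val hS _).symm)
      exact card_filter_map_swap S t (Fin.succAbove_ne _ k)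
    · rw [hasDegree_hat a S hS, hasDegree_hat a _ (by rwa [Finset.card_map])]

theorem castSucc_covBy_succ (t : Fin m) : t.castSucc ⋖ t.succ :=
  ⟨Fin.castSucc_lt_succ, fun c h1 h2 => by
    simp only [Fin.lt_def, Fin.val_castSucc, Fin.val_succ] at h1 h2
    omega⟩

theorem mem_normalizedModule_of_faces {y : Grassmann (Fin (m + 1)) (X _⦋m + 1⦌)}
    (hl : map (faceHom X (Fin.last (m + 1))) y Finset.univ = 0)
    (hi : ∀ t : Fin m,
      map (faceHom X t.succ.castSucc) y Finset.univ = 0) :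
    y Finset.univ ∈ normalizedModule X (m + 1) := by
  rw [mem_normalizedModule_succ]
  intro i
  refine Fin.lastCases ?_ (fun t => ?_) i
  · exact hl
  · exact hi t

/-- The full set contains the last variable and every neighbouring pair, so the vanishing lemmas
apply to every face `d_i` with `i > 0`. -/
theorem mul_univ_mem {a : X _⦋p⦌} {b : X _⦋q⦌} (ha : a ∈ normalizedModule X p)
    (hb : b ∈ normalizedModule X q) (n : ℕ) :
    (hat n a * hat n b) Finset.univ ∈ normalizedModule X n := by
  cases n with
  | zero => exact Submodule.mem_top
  | succ n =>
    refine mem_normalizedModule_of_faces ?_ fun t => ?_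
    · rw [map_mul]
      exact (avoids_map_δ_last_hat ha).mul (avoids_map_δ_last_hat hb) _ (Finset.mem_univ _)
    · rw [map_mul]
      exact (merges_map_δ_hat ha t).mul_eq_zero (castSucc_covBy_succ t) (merges_map_δ_hat hb t)
        (Finset.mem_univ _) (Finset.mem_univ _)

theorem dp_univ_mem {a : X _⦋n⦌} (ha : a ∈ normalizedModule X n) (h0 : 0 < n)
    (i m : ℕ) : dp n i (hat m a) Finset.univ ∈ normalizedModule X m := by
  cases m with
  | zero => exact Submodule.mem_top
  | succ m =>
    refine mem_normalizedModule_of_faces ?_ fun t => ?_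
    · rw [map_dp]
      exact (avoids_map_δ_last_hat ha).dp ((hasDegree_hat a).map _) h0 i _ (Finset.mem_univ _)
    · rw [map_dp]
      exact (merges_map_δ_hat ha t).dp_eq_zero (castSucc_covBy_succ t) ((hasDegree_hat a).map _)
        h0 i (Finset.mem_univ _) (Finset.mem_univ _)

end Hat

end Grassmann

/-! ### The normalization is a divided power chain algebra -/

namespace Grassmann

section Normalized

variable {R : Type u} [CommRing R] {X : SimplicialObject (CommAlgCat.{w} R)}

theorem apply_univ_succ {P : Type*} [CommRing P] {m : ℕ} (y : Grassmann (Fin (m + 1)) P) :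
    y Finset.univ = contract y Finset.univ := by
  rw [contract_apply]
  congr 1
  ext k
  refine Fin.cases ?_ (fun k => ?_) k <;> simp

theorem eq_of_hat_eq {n : ℕ} {a b : normalizedModule X n} (h : hat n a.1 = hat n b.1) : a = b := by
  have h' := congrFun h Finset.univ
  rw [hat_apply_univ, hat_apply_univ] at h'
  exact Subtype.ext h'

/-- The shuffle product on the normalization. -/
def shuffleMul {p q n : ℕ} (a : normalizedModule X p) (b : normalizedModule X q) :
    normalizedModule X n :=
  ⟨(hat n a.1 * hat n b.1) Finset.univ, mul_univ_mem a.2 b.2 n⟩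

/-- The divided powers on the normalization. -/
def shuffleDP (i : ℕ) {n m : ℕ} (h0 : 0 < n) (a : normalizedModule X n) :
    normalizedModule X m :=
  ⟨dp n i (hat m a.1) Finset.univ, dp_univ_mem a.2 h0 i m⟩

variable {p q n m : ℕ}

theorem hat_shuffleMul (h : p + q = n) (a : normalizedModule X p) (b : normalizedModule X q)
    (m : ℕ) : hat m (shuffleMul a b : normalizedModule X n).1 = hat m a.1 * hat m b.1 :=
  hat_mul_univ h a.1 b.1 m

theorem hat_shuffleDP {i : ℕ} (h0 : 0 < n) (h : n * i = m) (a : normalizedModule X n) (k : ℕ) :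
    hat k (shuffleDP i h0 a : normalizedModule X m).1 = dp n i (hat k a.1) :=
  hat_dp_univ h0 h a.1 k

theorem hat_normalizedD (a : normalizedModule X (n + 1)) :
    hat m (normalizedD X n a).1 = contract (map (faceHom X 0) (hat (m + 1) a.1)) :=
  (contract_map_δ_zero_hat a.1).symm

theorem normalizedComplex_d_apply (a : normalizedModule X (n + 1)) :
    ((normalizedComplex X).d (n + 1) n).hom a = normalizedD X n a := by
  rw [normalizedComplex_d]
  rfl

/-- The full set contains the smallest variable, so `d_0` of the top coefficient is the top
coefficient of the contraction, and the antiderivation rule applies. -/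
theorem faceHom_zero_mul_apply_univ (a : X _⦋p⦌) (b : X _⦋q⦌) :
    faceHom X 0 ((hat (m + 1) a * hat (m + 1) b) Finset.univ)
      = (contract (map (faceHom X 0) (hat (m + 1) a)) * hat m b
        + (-1 : X _⦋m⦌) ^ p •
          (hat m a * contract (map (faceHom X 0) (hat (m + 1) b)))) Finset.univ := by
  rw [← map_apply, map_mul]
  refine (apply_univ_succ _).trans ?_
  rw [contract_mul ((hasDegree_hat a).map _),
    restrict_map_δ_zero_hat, restrict_map_δ_zero_hat]

/-- The shuffle product as a bilinear map. -/
def shuffleMulHom (X : SimplicialObject (CommAlgCat.{w} R)) (p q n : ℕ) :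
    normalizedModule X p →ₗ[R] normalizedModule X q →ₗ[R] normalizedModule X n :=
  LinearMap.mk₂ R shuffleMul
    (fun a a' b => Subtype.ext (by
      change (hat n (a.1 + a'.1) * hat n b.1) Finset.univ = _
      rw [hat_add, add_mul]
      rfl))
    (fun r a b => Subtype.ext (by
      change (hat n (r • a.1) * hat n b.1) Finset.univ
        = r • (hat n a.1 * hat n b.1) Finset.univ
      rw [hat_smul, smul_mul_assoc, smul_apply, Algebra.smul_def]))
    (fun a b b' => Subtype.ext (by
      change (hat n a.1 * hat n (b.1 + b'.1)) Finset.univ = _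
      rw [hat_add, mul_add]
      rfl))
    (fun r a b => Subtype.ext (by
      change (hat n a.1 * hat n (r • b.1)) Finset.univ
        = r • (hat n a.1 * hat n b.1) Finset.univ
      rw [hat_smul, mul_smul_comm, smul_apply, Algebra.smul_def]))

/-- The normalization with the shuffle product. -/
def normalizedCDGA (X : SimplicialObject (CommAlgCat.{w} R)) :
    CommDGAlgebra (normalizedComplex X) where
  one := (⟨1, Submodule.mem_top⟩ : normalizedModule X 0)
  mul {p q n} _ := shuffleMulHom X p q n
  one_mul {n} a := by
    change normalizedModule X n at a
    refine Subtype.ext ?_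
    change (hat n (1 : X _⦋0⦌) * hat n a.1) Finset.univ = a.1
    rw [hat_one, one_mul, hat_apply_univ]
  mul_one {n} a := by
    change normalizedModule X n at a
    refine Subtype.ext ?_
    change (hat n a.1 * hat n (1 : X _⦋0⦌)) Finset.univ = a.1
    rw [hat_one, mul_one, hat_apply_univ]
  mul_assoc {p q r pq qr n} hpq hn hqr hn' a b c := by
    change normalizedModule X p at a
    change normalizedModule X q at b
    change normalizedModule X r at c
    refine Subtype.ext ?_
    change (hat n (shuffleMul (n := pq) a b).1 * hat n c.1) Finset.univ
      = (hat n a.1 * hat n (shuffleMul (n := qr) b c).1) Finset.univ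
    rw [hat_shuffleMul hpq, hat_shuffleMul hqr, mul_assoc]
  mul_comm {p q n} h h' a b := by
    change normalizedModule X p at a
    change normalizedModule X q at b
    refine Subtype.ext ?_
    change (hat n a.1 * hat n b.1) Finset.univ
      = (-1 : R) ^ (p * q) • (hat n b.1 * hat n a.1) Finset.univ
    rw [(hasDegree_hat a.1).mul_comm (hasDegree_hat b.1), smul_apply, Algebra.smul_def, map_pow,
      map_neg, map_one]
  leibniz {p q n} h h₁ h₂ a b := by
    change normalizedModule X (p + 1) at a
    change normalizedModule X (q + 1) at b
    refine (normalizedComplex_d_apply _).trans ?_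
    rw [normalizedComplex_d_apply, normalizedComplex_d_apply]
    refine Subtype.ext ((faceHom_zero_mul_apply_univ a.1 b.1).trans ?_)
    rw [← hat_normalizedD, ← hat_normalizedD]
    change _ = (hat n (normalizedD X p a).1 * hat n b.1) Finset.univ
      + (-1 : R) ^ (p + 1) • (hat n a.1 * hat n (normalizedD X q b).1) Finset.univ
    rw [add_apply, smul_apply, Algebra.smul_def, map_pow, map_neg, map_one]
  leibniz_zero_left {q} a b := by
    change normalizedModule X 0 at a
    change normalizedModule X (q + 1) at b
    refine (normalizedComplex_d_apply _).trans ?_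
    rw [normalizedComplex_d_apply]
    refine Subtype.ext ((faceHom_zero_mul_apply_univ a.1 b.1).trans ?_)
    rw [← hat_normalizedD, contract_map_δ_zero_hat_degree_zero, zero_mul, zero_add, pow_zero,
      one_smul]
    rfl
  leibniz_zero_right {p} a b := by
    change normalizedModule X (p + 1) at a
    change normalizedModule X 0 at b
    refine (normalizedComplex_d_apply _).trans ?_
    rw [normalizedComplex_d_apply]
    refine Subtype.ext ((faceHom_zero_mul_apply_univ a.1 b.1).trans ?_)
    rw [← hat_normalizedD, contract_map_δ_zero_hat_degree_zero, mul_zero, smul_zero, add_zero]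
    rfl

theorem hat_npow (a : normalizedModule X n) (i m : ℕ) :
    hat m (show normalizedModule X (n * i) from (normalizedCDGA X).npow a i).1
      = hat m a.1 ^ i := by
  induction i with
  | zero => exact hat_one.trans (pow_zero _).symm
  | succ i ih =>
    rw [pow_succ, ← ih]
    exact hat_shuffleMul (n := n * (i + 1)) rfl _ a m

theorem Avoids.contract {P : Type*} [CommRing P] {x : Grassmann (Fin (m + 1)) P} {a : Fin m}
    (hx : Avoids x a.succ) : Avoids (contract x) a := fun S hS =>
  hx _ (by simp [hS])

theorem Merges.avoids_contract {P : Type*} [CommRing P] {x : Grassmann (Fin (m + 2)) P}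
    (hx : Merges x 0 1) : Avoids (contract x) 0 := fun _ hS =>
  hx.1 _ (Finset.mem_insert_self _ _) (Finset.mem_insert_of_mem (Finset.mem_map.2 ⟨0, hS, rfl⟩))

theorem Merges.contract {P : Type*} [CommRing P] {x : Grassmann (Fin (m + 1)) P} {a b : Fin m}
    (hx : Merges x a.succ b.succ) : Merges (contract x) a b := by
  refine ⟨fun S ha hb => hx.1 _ (by simp [ha]) (by simp [hb]), fun S => ?_⟩
  refine Eq.trans ?_ (hx.2 _)
  rw [contract_apply]
  congr 1
  rw [Finset.map_insert, Finset.map_map, Finset.map_map]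
  congr 1
  congr 1
  ext k : 1
  exact ((Fin.succ_injective m).swap_apply a b k).symm

/-- The form `hat (k + 2) b` is contracted over `X_{k+2}` before any face is applied. Its divided
power has a top coefficient `w` in `X_{k+2}`, and applying `d_0` to the coefficients turns the
contraction into the form of `d b`. -/
theorem exists_normalizedD_eq_shuffleDP (h0 : 0 < n) {i : ℕ} (hi : 1 ≤ i) (h : n * i = m)
    (b : normalizedModule X (n + 1)) :
    ∃ w : normalizedModule X (m + 1),
      normalizedD X m w = shuffleDP i h0 (normalizedD X n b) := by
  obtain ⟨k, rfl⟩ : ∃ k, m = k + 1 := ⟨m - 1, by have := Nat.mul_pos h0 hi; omega⟩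
  have hd : ∀ j : Fin (k + 3), HasDegree
      (contract (map (faceHom X j) (hat (k + 2) b.1))) n := fun j =>
    ((hasDegree_hat b.1).map _).contract
  have hmap : ∀ j : Fin (k + 3),
      faceHom X j (dp n i (contract (hat (k + 2) b.1)) Finset.univ)
        = dp n i (contract (map (faceHom X j) (hat (k + 2) b.1))) Finset.univ := fun j => by
    rw [← map_apply, map_dp]
    rfl
  refine ⟨⟨dp n i (contract (hat (k + 2) b.1)) Finset.univ, ?_⟩, ?_⟩
  · rw [mem_normalizedModule_succ]
    intro j
    refine (hmap j.succ).trans ?_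
    refine Fin.lastCases ?_ (fun t => ?_) j
    · refine Avoids.dp (a := Fin.last k) ?_ (hd _) h0 i _ (Finset.mem_univ _)
      exact (avoids_map_δ_last_hat b.2).contract
    -- The face `d_1` merges the variables `0` and `1`; since `0` has been split off, no term with
    -- `1` remains. The higher inner faces merge two surviving neighbours.
    · refine Fin.cases ?_ (fun s => ?_) t
      · refine Avoids.dp (a := 0) ?_ (hd _) h0 i _ (Finset.mem_univ _)
        exact (merges_map_δ_hat b.2 0).avoids_contract
      · refine Merges.dp_eq_zero (castSucc_covBy_succ s) ?_ (hd _) h0 i (Finset.mem_univ _)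
          (Finset.mem_univ _)
        exact (merges_map_δ_hat b.2 s.succ).contract
  · refine Subtype.ext ((hmap 0).trans ?_)
    rw [← hat_normalizedD]
    rfl

/-- The normalization of a simplicial commutative algebra with the shuffle product and the shuffle
divided powers. -/
def normalizedDPCA (X : SimplicialObject (CommAlgCat.{w} R)) :
    DividedPowerChainAlgebra (normalizedComplex X) where
  toCommDGAlgebra := normalizedCDGA X
  γ i {n m} h0 _ a := (shuffleDP i h0 a : normalizedModule X m)
  γ_zero {n} h0 a := by
    change normalizedModule X n at a
    refine Subtype.ext ?_
    change dp n 0 (hat (n * 0) a.1) Finset.univ = (1 : X _⦋0⦌)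
    rw [dp_zero (hasDegree_hat a.1) h0]
    rfl
  γ_one {n} h0 a := by
    change normalizedModule X n at a
    refine Subtype.ext ?_
    change dp n 1 (hat n a.1) Finset.univ = a.1
    rw [dp_one (hasDegree_hat a.1) h0]
    exact hat_apply_univ a.1
  γ_odd {i n m} h0 h a hn hi := by
    change normalizedModule X n at a
    refine Subtype.ext ?_
    change dp n i (hat m a.1) Finset.univ = 0
    rw [dp_odd (hasDegree_hat a.1) hn hi, zero_apply]
  γ_smul {i n m} h0 h r a := by
    change normalizedModule X n at a
    refine Subtype.ext ?_
    change dp n i (hat m (r • a.1)) Finset.univ = r ^ i • dp n i (hat m a.1) Finset.univ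
    rw [hat_smul, dp_smul (hasDegree_hat a.1) h0, smul_apply, Algebra.smul_def, map_pow]
  γ_mul_degree_zero {i n m} h0 h h' r a := by
    change normalizedModule X n at a
    change normalizedModule X 0 at r
    refine eq_of_hat_eq ((hat_shuffleDP h0 h _ m).trans (Eq.trans ?_
      (hat_shuffleMul h' _ (shuffleDP i h0 a) m).symm))
    rw [hat_npow, hat_shuffleDP h0 h]
    refine (congrArg (dp n i) (hat_shuffleMul (Nat.zero_add n) r a m)).trans ?_
    rw [hat_degree_zero, smul_mul_assoc, one_mul, dp_smul (hasDegree_hat a.1) h0, smul_pow,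
      one_pow, smul_mul_assoc, one_mul]
  γ_mul_γ {i j n m} h0 h h' a := by
    change normalizedModule X n at a
    refine Subtype.ext ?_
    change (hat m (shuffleDP (m := n * i) i h0 a).1 * hat m (shuffleDP (m := n * j) j h0 a).1)
      Finset.univ = (i + j).choose i • dp n (i + j) (hat m a.1) Finset.univ
    rw [hat_shuffleDP h0 rfl, hat_shuffleDP h0 rfl, dp_mul_dp (hasDegree_hat a.1) h0, nsmul_apply]
  γ_add {i n m} h0 hn h h' a b := by
    change normalizedModule X n at a
    change normalizedModule X n at b
    refine Subtype.ext ?_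
    refine Eq.trans ?_ (map_sum (normalizedModule X m).subtype _ _).symm
    change dp n i (hat m (a.1 + b.1)) Finset.univ = ∑ k : Fin (i + 1),
      (hat m (shuffleDP (m := n * k.val) k.val h0 a).1 *
        hat m (shuffleDP (m := n * (i - k.val)) (i - k.val) h0 b).1) Finset.univ
    rw [hat_add, dp_add (hasDegree_hat a.1) (hasDegree_hat b.1) hn h0, sum_apply,
      Finset.sum_range]
    refine Finset.sum_congr rfl fun k _ => ?_
    rw [hat_shuffleDP h0 rfl, hat_shuffleDP h0 rfl]
  γ_mul {i p q n m} hp hq hn h hm hm' a b := by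
    change normalizedModule X p at a
    change normalizedModule X q at b
    refine Subtype.ext ?_
    change dp n i (hat m (shuffleMul (n := n) a b).1) Finset.univ = i.factorial •
      (hat m (shuffleDP (m := p * i) i hp a).1 * hat m (shuffleDP (m := q * i) i hq b).1)
        Finset.univ
    subst h
    -- The rule with `a ^ i` on the left, combined with `a ^ i = i! γ_i(a)`.
    rw [hat_shuffleMul rfl, hat_shuffleDP hp rfl, hat_shuffleDP hq rfl,
      dp_mul_left (hasDegree_hat a.1) (hasDegree_hat b.1) hq,
      ← factorial_nsmul_dp (hasDegree_hat a.1) hp, smul_mul_assoc, nsmul_apply]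
  γ_mul_left {i p q n m} hp hq hn h hm hm' a b := by
    change normalizedModule X p at a
    change normalizedModule X q at b
    refine eq_of_hat_eq ((hat_shuffleDP hn hm _ m).trans (Eq.trans ?_
      (hat_shuffleMul hm' _ (shuffleDP i hq b) m).symm))
    rw [hat_npow, hat_shuffleDP hq rfl]
    refine (congrArg (dp n i) (hat_shuffleMul h a b m)).trans ?_
    subst h
    exact dp_mul_left (hasDegree_hat a.1) (hasDegree_hat b.1) hq i
  γ_mul_right {i p q n m} hp hq hn h hm hm' a b := by
    change normalizedModule X p at a
    change normalizedModule X q at b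
    refine eq_of_hat_eq ((hat_shuffleDP hn hm _ m).trans (Eq.trans ?_
      (hat_shuffleMul hm' (shuffleDP i hp a) _ m).symm))
    rw [hat_npow, hat_shuffleDP hp rfl]
    refine (congrArg (dp n i) (hat_shuffleMul h a b m)).trans ?_
    subst h
    exact dp_mul_right (hasDegree_hat a.1) (hasDegree_hat b.1) hp i
  γ_γ {i j n m} h0 hnj h h' a := by
    change normalizedModule X n at a
    refine Subtype.ext ?_
    change dp (n * j) i (hat m (shuffleDP (m := n * j) j h0 a).1) Finset.univ
      = ((i * j).factorial / (i.factorial * j.factorial ^ i)) •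
        dp n (i * j) (hat m a.1) Finset.univ
    rw [hat_shuffleDP h0 rfl, dp_comp (hasDegree_hat a.1) h0 i (Nat.pos_of_mul_pos_left hnj),
      nsmul_apply]
  d_γ {i n m} hn h h' c := by
    change normalizedModule X (n + 1) at c
    refine (normalizedComplex_d_apply _).trans ?_
    rw [normalizedComplex_d_apply]
    refine Subtype.ext ?_
    change faceHom X 0 (dp (n + 1) (i + 1) (hat (m + 1) c.1) Finset.univ)
      = (hat m (normalizedD X n c).1 * hat m (shuffleDP (m := (n + 1) * i) i n.succ_pos c).1)
        Finset.univ
    rw [hat_shuffleDP n.succ_pos rfl, ← map_apply, map_dp]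
    refine (apply_univ_succ _).trans ?_
    rw [contract_dp ((hasDegree_hat c.1).map _) hn n.succ_pos, restrict_map_δ_zero_hat,
      hat_normalizedD]
  γ_boundary {i n m} h0 h c hi := by
    rintro ⟨b, rfl⟩
    obtain ⟨w, hw⟩ := exists_normalizedD_eq_shuffleDP h0 hi h b
    exact ⟨w, (normalizedComplex_d_apply w).trans
      (hw.trans (congrArg (shuffleDP i h0) (normalizedComplex_d_apply b).symm))⟩

end Normalized

/-! ### Agreement with the shuffle formulas -/

section Formulas

variable {R : Type u} [CommRing R] {X : SimplicialObject (CommAlgCat.{w} R)}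

open Classical in
theorem normalizedIncl_mul {p q : ℕ} (a : (normalizedComplex X).X p)
    (b : (normalizedComplex X).X q) :
    normalizedIncl X (p + q) ((normalizedDPCA X).mul rfl a b)
      = shuffleProduct X (normalizedIncl X p a) (normalizedIncl X q b) := by
  refine (mul_apply_univ (hasDegree_hat _) (hasDegree_hat _)).trans ?_
  rw [shuffleProduct]
  refine Finset.sum_congr rfl fun σ hσ => ?_
  have h := (Finset.mem_filter.1 hσ).2
  rw [hat_image h.1, hat_image h.2]
  rfl

open Classical in
theorem normalizedIncl_γ {n : ℕ} (h0 : 0 < n) (hn : Even n) (i : ℕ)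
    (a : (normalizedComplex X).X n) :
    normalizedIncl X (i * n) ((normalizedDPCA X).γ i h0 (Nat.mul_comm n i) a)
      = shuffleDividedPower X i h0 (normalizedIncl X n a) := by
  refine (dp_apply_univ h0 (hasDegree_hat _) hn).trans ?_
  rw [shuffleDividedPower]
  refine Finset.sum_congr rfl fun σ hσ => ?_
  have h := (Finset.mem_filter.1 hσ).2
  rw [shuffleTerm]
  congr 1
  refine Finset.prod_congr rfl fun j _ => ?_
  rw [hat_image (h.1 j)]
  rfl

end Formulas

end Grassmann

/-! ### Quotients of divided power chain algebras -/

section Quotient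

variable {R : Type u} [CommRing R] {K L : ChainComplex (ModuleCat.{w} R) ℕ}

theorem CommDGAlgebra.eq_of_mul_eq {D E : CommDGAlgebra K} (h1 : D.one = E.one)
    (h2 : @D.mul = @E.mul) : D = E := by
  cases D
  cases E
  simp only at h1 h2
  subst h1 h2
  rfl

theorem DividedPowerChainAlgebra.eq_of_γ_eq {D E : DividedPowerChainAlgebra K}
    (h1 : D.toCommDGAlgebra = E.toCommDGAlgebra) (h2 : @D.γ = @E.γ) : D = E := by
  cases D
  cases E
  simp only at h1 h2
  subst h1 h2
  rfl

/-- All operations on the target are determined by their values on images, and every element is an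
image. -/
theorem DividedPowerChainAlgebra.eq_of_isMorphism {D : DividedPowerChainAlgebra K}
    {E E' : DividedPowerChainAlgebra L} {f : K ⟶ L}
    (hf : ∀ n, Function.Surjective (f.f n).hom) (hE : D.IsMorphism E f)
    (hE' : D.IsMorphism E' f) : E = E' := by
  refine eq_of_γ_eq (CommDGAlgebra.eq_of_mul_eq (hE.map_one.symm.trans hE'.map_one) ?_) ?_
  · funext p q n h
    refine LinearMap.ext₂ fun a b => ?_
    obtain ⟨a, rfl⟩ := hf p a
    obtain ⟨b, rfl⟩ := hf q b
    rw [← hE.map_mul, ← hE'.map_mul]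
  · funext i n m hn h a
    obtain ⟨a, rfl⟩ := hf n a
    rw [← hE.map_γ, ← hE'.map_γ]

theorem hom_d_apply (f : K ⟶ L) (i j : ℕ) (a : K.X i) :
    (L.d i j).hom ((f.f i).hom a) = (f.f j).hom ((K.d i j).hom a) :=
  congrArg (fun g => g.hom a) (f.comm i j)

variable (D : DividedPowerChainAlgebra K) (f : K ⟶ L)
  (hf : ∀ n, Function.Surjective (f.f n).hom)
  (hmul : ∀ {p q n : ℕ} (h : p + q = n) {a a' : K.X p} {b b' : K.X q},
    (f.f p).hom a = (f.f p).hom a' → (f.f q).hom b = (f.f q).hom b' →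
      (f.f n).hom (D.mul h a b) = (f.f n).hom (D.mul h a' b'))
  (hγ : ∀ {i n m : ℕ} (hn : 0 < n) (h : n * i = m) {a a' : K.X n},
    (f.f n).hom a = (f.f n).hom a' → (f.f m).hom (D.γ i hn h a) = (f.f m).hom (D.γ i hn h a'))

/-- The product induced on a quotient. -/
def quotientMul {p q n : ℕ} (h : p + q = n) : L.X p →ₗ[R] L.X q →ₗ[R] L.X n :=
  LinearMap.mk₂ R
    (fun a b => (f.f n).hom (D.mul h (Function.surjInv (hf p) a) (Function.surjInv (hf q) b)))
    (fun a a' b => by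
      rw [← map_add, ← LinearMap.add_apply, ← map_add]
      exact hmul h (by simp only [map_add, Function.surjInv_eq]) rfl)
    (fun r a b => by
      rw [← map_smul, ← LinearMap.smul_apply, ← map_smul]
      exact hmul h (by simp only [map_smul, Function.surjInv_eq]) rfl)
    (fun a b b' => by
      rw [← map_add, ← map_add]
      exact hmul h rfl (by simp only [map_add, Function.surjInv_eq]))
    (fun r a b => by
      rw [← map_smul, ← map_smul]
      exact hmul h rfl (by simp only [map_smul, Function.surjInv_eq]))

theorem quotientMul_apply {p q n : ℕ} (h : p + q = n) (a : K.X p) (b : K.X q) :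
    quotientMul D f hf hmul h ((f.f p).hom a) ((f.f q).hom b) = (f.f n).hom (D.mul h a b) :=
  hmul h (Function.surjInv_eq _ _) (Function.surjInv_eq _ _)

/-- The commutative differential graded algebra structure induced on a quotient. -/
def quotientCDGA : CommDGAlgebra L where
  one := (f.f 0).hom D.one
  mul h := quotientMul D f hf hmul h
  one_mul {n} a := by
    obtain ⟨a, rfl⟩ := hf _ a
    rw [quotientMul_apply, D.one_mul]
  mul_one {n} a := by
    obtain ⟨a, rfl⟩ := hf _ a
    rw [quotientMul_apply, D.mul_one]
  mul_assoc hpq hn hqr hn' a b c := by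
    obtain ⟨a, rfl⟩ := hf _ a
    obtain ⟨b, rfl⟩ := hf _ b
    obtain ⟨c, rfl⟩ := hf _ c
    simp only [quotientMul_apply]
    rw [D.mul_assoc hpq hn hqr hn']
  mul_comm h h' a b := by
    obtain ⟨a, rfl⟩ := hf _ a
    obtain ⟨b, rfl⟩ := hf _ b
    rw [quotientMul_apply, quotientMul_apply, D.mul_comm h h', map_smul]
  leibniz h h₁ h₂ a b := by
    obtain ⟨a, rfl⟩ := hf _ a
    obtain ⟨b, rfl⟩ := hf _ b
    rw [quotientMul_apply, hom_d_apply, hom_d_apply, hom_d_apply, quotientMul_apply,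
      quotientMul_apply, D.leibniz h h₁ h₂, map_add, map_smul]
  leibniz_zero_left a b := by
    obtain ⟨a, rfl⟩ := hf _ a
    obtain ⟨b, rfl⟩ := hf _ b
    rw [quotientMul_apply, hom_d_apply, hom_d_apply, quotientMul_apply, D.leibniz_zero_left]
  leibniz_zero_right a b := by
    obtain ⟨a, rfl⟩ := hf _ a
    obtain ⟨b, rfl⟩ := hf _ b
    rw [quotientMul_apply, hom_d_apply, hom_d_apply, quotientMul_apply, D.leibniz_zero_right]

theorem quotientCDGA_mul {p q n : ℕ} (h : p + q = n) (a : K.X p) (b : K.X q) :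
    (quotientCDGA D f hf hmul).mul h ((f.f p).hom a) ((f.f q).hom b)
      = (f.f n).hom (D.mul h a b) :=
  quotientMul_apply D f hf hmul h a b

theorem quotientCDGA_npow {n : ℕ} (a : K.X n) (i : ℕ) :
    (quotientCDGA D f hf hmul).npow ((f.f n).hom a) i = (f.f (n * i)).hom (D.npow a i) := by
  induction i with
  | zero => rfl
  | succ i ih =>
    change (quotientCDGA D f hf hmul).mul rfl ((quotientCDGA D f hf hmul).npow _ i) _ = _
    rw [ih, quotientCDGA_mul]
    rfl

/-- The divided powers induced on a quotient. -/
def quotientγ (i : ℕ) {n m : ℕ} (hn : 0 < n) (h : n * i = m) (a : L.X n) : L.X m :=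
  (f.f m).hom (D.γ i hn h (Function.surjInv (hf n) a))

include hγ in
theorem quotientγ_apply (i : ℕ) {n m : ℕ} (hn : 0 < n) (h : n * i = m) (a : K.X n) :
    quotientγ D f hf i hn h ((f.f n).hom a) = (f.f m).hom (D.γ i hn h a) :=
  hγ hn h (Function.surjInv_eq _ _)

/-- The divided power chain algebra structure induced on a quotient. -/
def quotientDPCA : DividedPowerChainAlgebra L where
  toCommDGAlgebra := quotientCDGA D f hf hmul
  γ i {n m} hn h a := quotientγ D f hf i hn h a
  γ_zero hn a := by
    obtain ⟨a, rfl⟩ := hf _ a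
    rw [quotientγ_apply D f hf hγ, D.γ_zero]
    rfl
  γ_one hn a := by
    obtain ⟨a, rfl⟩ := hf _ a
    rw [quotientγ_apply D f hf hγ, D.γ_one]
  γ_odd hn h a ho hi := by
    obtain ⟨a, rfl⟩ := hf _ a
    rw [quotientγ_apply D f hf hγ, D.γ_odd hn h a ho hi, map_zero]
  γ_smul hn h r a := by
    obtain ⟨a, rfl⟩ := hf _ a
    rw [← map_smul, quotientγ_apply D f hf hγ, quotientγ_apply D f hf hγ, D.γ_smul, map_smul]
  γ_mul_degree_zero hn h h' r a := by
    obtain ⟨a, rfl⟩ := hf _ a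
    obtain ⟨r, rfl⟩ := hf _ r
    rw [quotientCDGA_mul, quotientCDGA_npow, quotientγ_apply D f hf hγ,
      quotientγ_apply D f hf hγ, quotientCDGA_mul, D.γ_mul_degree_zero hn h h']
  γ_mul_γ hn h h' a := by
    obtain ⟨a, rfl⟩ := hf _ a
    simp only [quotientγ_apply D f hf hγ, quotientCDGA_mul]
    rw [D.γ_mul_γ hn h h', map_nsmul]
  γ_add hn he h h' a b := by
    obtain ⟨a, rfl⟩ := hf _ a
    obtain ⟨b, rfl⟩ := hf _ b
    simp only [← map_add, quotientγ_apply D f hf hγ, quotientCDGA_mul]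
    rw [D.γ_add hn he h h', map_sum]
  γ_mul hp hq hn h hm hm' a b := by
    obtain ⟨a, rfl⟩ := hf _ a
    obtain ⟨b, rfl⟩ := hf _ b
    simp only [quotientγ_apply D f hf hγ, quotientCDGA_mul]
    rw [D.γ_mul hp hq hn h hm hm', map_nsmul]
  γ_mul_left hp hq hn h hm hm' a b := by
    obtain ⟨a, rfl⟩ := hf _ a
    obtain ⟨b, rfl⟩ := hf _ b
    simp only [quotientγ_apply D f hf hγ, quotientCDGA_npow, quotientCDGA_mul]
    rw [D.γ_mul_left hp hq hn h hm hm']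
  γ_mul_right hp hq hn h hm hm' a b := by
    obtain ⟨a, rfl⟩ := hf _ a
    obtain ⟨b, rfl⟩ := hf _ b
    simp only [quotientγ_apply D f hf hγ, quotientCDGA_npow, quotientCDGA_mul]
    rw [D.γ_mul_right hp hq hn h hm hm']
  γ_γ hn hnj h h' a := by
    obtain ⟨a, rfl⟩ := hf _ a
    simp only [quotientγ_apply D f hf hγ]
    rw [D.γ_γ hn hnj h h', map_nsmul]
  d_γ hn h h' c := by
    obtain ⟨c, rfl⟩ := hf _ c
    simp only [quotientγ_apply D f hf hγ, hom_d_apply, quotientCDGA_mul]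
    rw [D.d_γ hn h h']
  γ_boundary hn h c hi := by
    rintro ⟨b, rfl⟩
    obtain ⟨b, rfl⟩ := hf _ b
    obtain ⟨w, hw⟩ := D.γ_boundary hn h _ hi ⟨b, rfl⟩
    exact ⟨(f.f _).hom w, by rw [hom_d_apply, hom_d_apply, quotientγ_apply D f hf hγ, hw]⟩

include hf hmul hγ in
theorem existsUnique_isMorphism : ∃! E : DividedPowerChainAlgebra L, D.IsMorphism E f := by
  refine existsUnique_of_exists_of_unique ⟨quotientDPCA D f hf hmul hγ, rfl, ?_, ?_⟩
    fun E E' h h' => DividedPowerChainAlgebra.eq_of_isMorphism hf h h'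
  · exact fun h a b => (quotientMul_apply D f hf hmul h a b).symm
  · exact fun hn h a => (quotientγ_apply D f hf hγ _ hn h a).symm

end Quotient

/-! ### The Hochschild complex as a quotient -/

section Hochschild

open Grassmann

variable (R : Type u) [CommRing R] (A : Type v) [CommRing A] [Algebra R A]

theorem algebraMap_mulAlgebra_surjective :
    Function.Surjective (algebraMap (A ⊗[R] A) A) := fun a =>
  ⟨a ⊗ₜ 1, by
    change Algebra.TensorProduct.lmul' R (S := A) (a ⊗ₜ 1) = a
    rw [Algebra.TensorProduct.lmul'_apply_tmul, mul_one]⟩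

theorem tensorProduct_mk_one_surjective {S B M : Type*} [CommRing S] [CommRing B] [Algebra S B]
    [AddCommGroup M] [Module S M] (h : Function.Surjective (algebraMap S B)) :
    Function.Surjective (TensorProduct.mk S B M 1) := fun z => by
  induction z with
  | zero => exact ⟨0, map_zero _⟩
  | tmul b x =>
    obtain ⟨s, rfl⟩ := h b
    refine ⟨s • x, ?_⟩
    rw [TensorProduct.mk_apply, ← TensorProduct.smul_tmul, Algebra.algebraMap_eq_smul_one]
  | add y z hy hz =>
    obtain ⟨y, rfl⟩ := hy
    obtain ⟨z, rfl⟩ := hz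
    exact ⟨y + z, map_add _ _ _⟩

/-- Surjectivity identifies `B` with `S` modulo an ideal `I`, and the kernel of `M → S/I ⊗ M` is `I
M`. -/
theorem ker_tensorProduct_mk_one {S B M : Type*} [CommRing S] [CommRing B] [Algebra S B]
    [AddCommGroup M] [Module S M] (h : Function.Surjective (algebraMap S B)) :
    LinearMap.ker (TensorProduct.mk S B M 1) = RingHom.ker (algebraMap S B) • ⊤ := by
  have hs : Function.Surjective (Algebra.ofId S B) := h
  let e := (Ideal.quotientKerAlgEquivOfSurjective hs).toLinearEquiv
  have he : e 1 = 1 := map_one (Ideal.quotientKerAlgEquivOfSurjective hs)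
  have hc : TensorProduct.mk S B M 1
      = (TensorProduct.congr e (LinearEquiv.refl S M)).toLinearMap ∘ₗ
        TensorProduct.mk S (S ⧸ RingHom.ker (Algebra.ofId S B)) M 1 := by
    ext x
    simp [he]
  rw [hc, LinearEquiv.ker_comp, LinearMap.ker_tensorProductMk]
  rfl

/-- The kernel of the multiplication `A ⊗ A → A`. -/
abbrev mulKer : Ideal (A ⊗[R] A) := RingHom.ker (algebraMap (A ⊗[R] A) A)

/-- The kernel of `B_n(A) → C_n(A)`. -/
def hochschildKer (n : ℕ) : Submodule (A ⊗[R] A) (normalizedModule (barConstruction R A) n) :=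
  mulKer R A • ⊤

theorem barToHochschild_surjective (n : ℕ) :
    Function.Surjective ((barToHochschild R A).f n).hom :=
  tensorProduct_mk_one_surjective (M := normalizedModule (barConstruction R A) n)
    (algebraMap_mulAlgebra_surjective R A)

variable {R A}

theorem barToHochschild_eq_iff {n : ℕ} (x y : normalizedModule (barConstruction R A) n) :
    ((barToHochschild R A).f n).hom x = ((barToHochschild R A).f n).hom y
      ↔ x - y ∈ hochschildKer R A n := by
  rw [hochschildKer, ← ker_tensorProduct_mk_one (algebraMap_mulAlgebra_surjective R A),
    LinearMap.sub_mem_ker_iff]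
  rfl

/-! ### Compatibility of products and divided powers with the action of `A ⊗ A` -/

theorem degeneracyOff_barOuter (n : ℕ) (t : A ⊗[R] A) :
    degeneracyOff (barConstruction R A) (Fin.elim0 : Fin 0 → Fin n) (barOuter R A 0 t)
      = barOuter R A n t := by
  suffices h : (degeneracyOff (barConstruction R A) (Fin.elim0 : Fin 0 → Fin n)).comp
      (barOuter R A 0) = barOuter R A n from DFunLike.congr_fun h t
  refine Algebra.TensorProduct.ext' fun a b => ?_
  -- The inner `countBelow` is the monotone map `[n] → [0]`; the outer one describes its effect on
  -- tensor factors, which sends the two factors to the outermost positions.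
  change multiplyAlong R A (countBelow (countBelow (Fin.elim0 : Fin 0 → Fin n)))
    (barOuter R A 0 (a ⊗ₜ b)) = barOuter R A n (a ⊗ₜ b)
  rw [barOuter_tmul, barOuter_tmul]
  refine (map_mul (multiplyAlong R A _) _ _).trans (congrArg₂ _ ?_ ?_)
  · refine (multiplyAlong_single R A _ _ a).trans ?_
    congr 2
    ext
    simp [countBelow]
  · refine (multiplyAlong_single R A _ _ b).trans ?_
    congr 2
    ext
    simp [countBelow]

theorem hat_barOuter (m : ℕ) (t : A ⊗[R] A) :
    hat (X := barConstruction R A) m (barOuter R A 0 t)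
      = barOuter R A m t • (1 : Grassmann _ _) := by
  rw [hat_degree_zero, degeneracyOff_barOuter]

/-- The action of `t` is the shuffle product with the element `barOuter R A 0 t` of degree zero,
whose form is constant. -/
theorem hat_barModule_smul {n : ℕ} (m : ℕ) (t : A ⊗[R] A)
    (x : normalizedModule (barConstruction R A) n) :
    hat (X := barConstruction R A) m (t • x).1 = barOuter R A m t • hat m x.1 := by
  have h : (t • x).1 = (hat (X := barConstruction R A) n (barOuter R A 0 t) * hat n x.1)
      Finset.univ := by
    rw [hat_barOuter, smul_mul_assoc, one_mul, Grassmann.smul_apply, hat_apply_univ]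
    rfl
  rw [h, hat_mul_univ (Nat.zero_add n), hat_barOuter, smul_mul_assoc, one_mul]

theorem shuffleMul_smul_left {p q n : ℕ} (t : A ⊗[R] A)
    (x : normalizedModule (barConstruction R A) p) (y : normalizedModule (barConstruction R A) q) :
    (shuffleMul (t • x) y : normalizedModule (barConstruction R A) n) = t • shuffleMul x y :=
  Subtype.ext (by
    change (hat n (t • x).1 * hat n y.1) Finset.univ
      = barOuter R A n t * (hat n x.1 * hat n y.1) Finset.univ
    rw [hat_barModule_smul, smul_mul_assoc, Grassmann.smul_apply])

theorem shuffleMul_smul_right {p q n : ℕ} (t : A ⊗[R] A)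
    (x : normalizedModule (barConstruction R A) p) (y : normalizedModule (barConstruction R A) q) :
    (shuffleMul x (t • y) : normalizedModule (barConstruction R A) n) = t • shuffleMul x y :=
  Subtype.ext (by
    change (hat n x.1 * hat n (t • y).1) Finset.univ
      = barOuter R A n t * (hat n x.1 * hat n y.1) Finset.univ
    rw [hat_barModule_smul, mul_smul_comm, Grassmann.smul_apply])

theorem shuffleDP_smul {n m : ℕ} (h0 : 0 < n) (i : ℕ) (t : A ⊗[R] A)
    (x : normalizedModule (barConstruction R A) n) :
    (shuffleDP i h0 (t • x) : normalizedModule (barConstruction R A) m)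
      = t ^ i • shuffleDP i h0 x :=
  Subtype.ext (by
    change dp n i (hat m (t • x).1) Finset.univ
      = barOuter R A m (t ^ i) * dp n i (hat m x.1) Finset.univ
    rw [hat_barModule_smul, dp_smul (hasDegree_hat x.1) h0, Grassmann.smul_apply, map_pow])

theorem smul_mem_hochschildKer {n : ℕ} {t : A ⊗[R] A} (ht : t ∈ mulKer R A)
    (x : normalizedModule (barConstruction R A) n) : t • x ∈ hochschildKer R A n :=
  Submodule.smul_mem_smul ht trivial

theorem shuffleMul_mem_left {p q n : ℕ} {x : normalizedModule (barConstruction R A) p}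
    (hx : x ∈ hochschildKer R A p) (y : normalizedModule (barConstruction R A) q) :
    shuffleMul x y ∈ hochschildKer R A n := by
  refine Submodule.smul_induction_on hx (fun t ht x _ => ?_) fun x x' h h' => ?_
  · rw [shuffleMul_smul_left]
    exact smul_mem_hochschildKer ht _
  · rw [show (shuffleMul (x + x') y : normalizedModule (barConstruction R A) n)
      = shuffleMul x y + shuffleMul x' y from
        LinearMap.map_add₂ (shuffleMulHom (barConstruction R A) p q n) x x' y]
    exact add_mem h h'

theorem shuffleMul_mem_right {p q n : ℕ} (x : normalizedModule (barConstruction R A) p)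
    {y : normalizedModule (barConstruction R A) q} (hy : y ∈ hochschildKer R A q) :
    shuffleMul x y ∈ hochschildKer R A n := by
  refine Submodule.smul_induction_on hy (fun t ht y _ => ?_) fun y y' h h' => ?_
  · rw [shuffleMul_smul_right]
    exact smul_mem_hochschildKer ht _
  · rw [show (shuffleMul x (y + y') : normalizedModule (barConstruction R A) n)
      = shuffleMul x y + shuffleMul x y' from
        map_add (shuffleMulHom (barConstruction R A) p q n x) y y']
    exact add_mem h h'

/-- The term `k = i`, where `γ_0(y) = 1`, is split off: each remaining term contains a divided power
of `y` of positive index. -/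
theorem shuffleDP_add {X : SimplicialObject (CommAlgCat.{w} R)} {n m i : ℕ} (h0 : 0 < n)
    (hn : Even n) (x y : normalizedModule X n) :
    (shuffleDP i h0 (x + y) : normalizedModule X m) = shuffleDP i h0 x +
      ∑ k ∈ Finset.range i, shuffleMul (shuffleDP k h0 x : normalizedModule X (n * k))
        (shuffleDP (i - k) h0 y : normalizedModule X (n * (i - k))) := by
  refine Subtype.ext ?_
  refine Eq.trans ?_ (map_add (normalizedModule X m).subtype _ _).symm
  rw [map_sum]
  change dp n i (hat m (x.1 + y.1)) Finset.univ = dp n i (hat m x.1) Finset.univ +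
    ∑ k ∈ Finset.range i, (hat m (shuffleDP (m := n * k) k h0 x).1 *
      hat m (shuffleDP (m := n * (i - k)) (i - k) h0 y).1) Finset.univ
  rw [hat_add, dp_add (hasDegree_hat x.1) (hasDegree_hat y.1) hn h0, Finset.sum_range_succ,
    Grassmann.add_apply, Nat.sub_self, dp_zero (hasDegree_hat y.1) h0, mul_one, add_comm,
    Grassmann.sum_apply]
  congr 1
  refine Finset.sum_congr rfl fun k _ => ?_
  rw [hat_shuffleDP h0 rfl, hat_shuffleDP h0 rfl]

/-- On a generator `t • x` homogeneity produces `t ^ i`, which lies in the ideal since `i > 0`; sums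
follow from the addition formula. -/
theorem shuffleDP_mem {n m i : ℕ} (h0 : 0 < n) (hn : Even n) (hi : 0 < i)
    {x : normalizedModule (barConstruction R A) n} (hx : x ∈ hochschildKer R A n) :
    shuffleDP i h0 x ∈ hochschildKer R A m := by
  revert m i
  refine Submodule.smul_induction_on (p := fun x => ∀ {i m : ℕ}, 0 < i →
    (shuffleDP i h0 x : normalizedModule (barConstruction R A) m) ∈ hochschildKer R A m) hx
    (fun t ht x _ i m hi => ?_) fun x y hx hy i m hi => ?_
  · rw [shuffleDP_smul]
    exact smul_mem_hochschildKer (Ideal.pow_mem_of_mem _ ht i hi) _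
  · rw [shuffleDP_add h0 hn]
    refine add_mem (hx hi) (sum_mem fun k hk => shuffleMul_mem_right _ (hy ?_))
    have := Finset.mem_range.1 hk
    omega

/-- In even degree, expand `γ_i` at `x = y + (x - y)`. In odd degree there is no addition formula to
use, but `γ_i` is zero for `i > 1`, constant for `i = 0` and the identity for `i = 1`. -/
theorem shuffleDP_sub_mem {n m i : ℕ} (h0 : 0 < n) (h : n * i = m)
    {x y : normalizedModule (barConstruction R A) n} (hxy : x - y ∈ hochschildKer R A n) :
    (shuffleDP i h0 x - shuffleDP i h0 y : normalizedModule (barConstruction R A) m)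
      ∈ hochschildKer R A m := by
  rcases n.even_or_odd with hn | hn
  · rw [← add_sub_cancel y x, shuffleDP_add h0 hn, add_sub_cancel_left]
    refine sum_mem fun k hk => shuffleMul_mem_right _ (shuffleDP_mem h0 hn ?_ hxy)
    have := Finset.mem_range.1 hk
    omega
  · rcases Nat.lt_or_ge 1 i with hi | hi
    · have h' : ∀ z : normalizedModule (barConstruction R A) n,
          (shuffleDP i h0 z : normalizedModule (barConstruction R A) m) = 0 := fun z =>
        (normalizedDPCA (barConstruction R A)).γ_odd h0 h z hn hi
      rw [h', h', sub_zero]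
      exact zero_mem _
    · subst h
      interval_cases i
      · have h' : ∀ z : normalizedModule (barConstruction R A) n,
            (shuffleDP 0 h0 z : normalizedModule (barConstruction R A) (n * 0))
              = (normalizedDPCA (barConstruction R A)).one :=
          (normalizedDPCA (barConstruction R A)).γ_zero h0
        rw [(h' x).trans (h' y).symm, sub_self]
        exact zero_mem _
      · rw [Nat.mul_one]
        have h' : ∀ z : normalizedModule (barConstruction R A) n,
            (shuffleDP 1 h0 z : normalizedModule (barConstruction R A) n) = z :=
          (normalizedDPCA (barConstruction R A)).γ_one h0
        rwa [h', h']

end Hochschild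

end

theorem mainTheorem7 {R : Type u} [CommRing R] {A : Type v} [CommRing A] [Algebra R A] :
    ∃ D : DividedPowerChainAlgebra (barComplex R A),
      normalizedIncl (barConstruction R A) 0 D.one = 1 ∧
      (∀ {p q : ℕ} (a : (barComplex R A).X p) (b : (barComplex R A).X q),
        normalizedIncl (barConstruction R A) (p + q) (D.mul rfl a b)
          = shuffleProduct (barConstruction R A)
              (normalizedIncl (barConstruction R A) p a)
              (normalizedIncl (barConstruction R A) q b)) ∧
      (∀ {n : ℕ} (hn : 0 < n) (_ : Even n) (i : ℕ) (a : (barComplex R A).X n),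
        normalizedIncl (barConstruction R A) (i * n) (D.γ i hn (Nat.mul_comm n i) a)
          = shuffleDividedPower (barConstruction R A) i hn
              (normalizedIncl (barConstruction R A) n a)) ∧
      ∃! E : DividedPowerChainAlgebra (hochschildComplex R A),
        D.IsMorphism E (barToHochschild R A) := by
  refine ⟨Grassmann.normalizedDPCA (barConstruction R A), rfl,
    fun a b => Grassmann.normalizedIncl_mul a b,
    fun hn he i a => Grassmann.normalizedIncl_γ hn he i a,
    existsUnique_isMorphism _ _ (barToHochschild_surjective R A) ?_ ?_⟩
  · intro p q n h a a' b b' ha hb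
    replace ha := (barToHochschild_eq_iff _ _).1 ha
    replace hb := (barToHochschild_eq_iff _ _).1 hb
    change normalizedModule (barConstruction R A) p at a a'
    change normalizedModule (barConstruction R A) q at b b'
    refine (barToHochschild_eq_iff (Grassmann.shuffleMul a b) (Grassmann.shuffleMul a' b')).2 ?_
    -- Changing one factor at a time isolates a factor in the kernel in each summand.
    have h1 : (Grassmann.shuffleMul a b - Grassmann.shuffleMul a' b' :
        normalizedModule (barConstruction R A) n)
        = Grassmann.shuffleMul (a - a') b + Grassmann.shuffleMul a' (b - b') := by
      have e1 := LinearMap.map_sub₂ (Grassmann.shuffleMulHom (barConstruction R A) p q n) a a' b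
      have e2 := map_sub (Grassmann.shuffleMulHom (barConstruction R A) p q n a') b b'
      exact (sub_add_sub_cancel _ _ _).symm.trans (congrArg₂ _ e1.symm e2.symm)
    rw [h1]
    exact add_mem (shuffleMul_mem_left ha b) (shuffleMul_mem_right a' hb)
  · intro i n m hn h a a' ha
    replace ha := (barToHochschild_eq_iff _ _).1 ha
    exact (barToHochschild_eq_iff _ _).2 (shuffleDP_sub_mem hn h ha)
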